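/- Let $\mu:\mathbb R^2\to\mathbb R$ be measurable and $1$-periodic in each variable, with $0<a\le\mu\le b<\infty$ almost everywhere, and suppose that $\mu$ has cubic symmetry: $\mu(-x_2,x_1)=\mu(x_1,x_2)$ for all $x\in\mathbb R^2$. Write $\langle\cdot\rangle=\int_{[0,1]^2}\cdot\,dx$, $(u,v)=\langle u\overline v\rangle$ (extended to the duality between the periodic Sobolev space $H^1$ and its antidual), $u_1\equiv1$, and $\widehat\mu(\mathbf g)=\langle\mu\, e^{-2\pi i\mathbf g\cdot\mathbf x}\rangle$ for $\mathbf g\in\mathbb Z^2$. For a unit vector $\boldsymbol\kappa\in\mathbb R^2$ let $\mathcal C_0u=-\nabla\cdot\mu\nabla u$ and $\mathcal C_1u=-i\boldsymbol\kappa\cdot\mu\nabla u-i\nabla\cdot(\mu\boldsymbol\kappa u)$, understood weakly on periodic $H^1$ functions, and define the effective shear coefficient $$\mu_{\rm eff}(\mu)=\langle\mu\rangle-(\mathcal C_1\mathcal C_0^{-1}\mathcal C_1u_1,u_1),$$ where $\mathcal C_0^{-1}\mathcal C_1u_1$ is any periodic $w\in H^1$ with $\mathcal C_0w=\mathcal C_1u_1$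 weakly. For $N=0,1,2,\dots$ let $$\mathcal C_{NN,0}=\big(\widehat\mu(\mathbf g-\mathbf g')\,\mathbf g\cdot\mathbf g'\big)_{|g_i|,|g_i'|\le N},\qquad \mathbf f_{NN}=\big(\widehat\mu(\mathbf g)\,g_1\big)_{|g_i|\le N},$$ $$\mu_{NN}(\mu)=\langle\mu\rangle-\mathbf f_{NN}\cdot\mathcal C_{NN,0}^{-1}\mathbf f_{NN},\qquad \widetilde\mu_{NN}(\mu)=\frac1{\mu_{NN}(\mu^{-1})},$$ where $\cdot$ is the Hermitian scalar product, $\mathcal C_{NN,0}^{-1}\mathbf f_{NN}$ is any preimage of $\mathbf f_{NN}$ under $\mathcal C_{NN,0}$, and $\mu_{NN}(\mu^{-1})$ is the same quantity with $\mu$ replaced by $1/\mu$. Then all these quantities are well defined: the preimages $\mathcal C_{NN,0}^{-1}\mathbf f_{NN}$ and $\mathcal C_0^{-1}\mathcal C_1u_1$ exist, the values of $\mu_{NN}$ and $\mu_{\rm eff}$ are real and do not depend on their choice, and $\mu_{NN}(\mu)>0$, $\mu_{NN}(\mu^{-1})>0$. Moreover, for every unit vector $\boldsymbol\kappa$ (so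 that $\mu_{\rm eff}$ does not depend on $\boldsymbol\kappa$), as $N\to\infty$ the sequence $\mu_{NN}(\mu)$ is non-increasing and converges to $\mu_{\rm eff}(\mu)$, and the sequence $\widetilde\mu_{NN}(\mu)$ is non-decreasing and converges to $\mu_{\rm eff}(\mu)$. -/

import Mathlib

open MeasureTheory Filter Topology
open scoped ContDiff Matrix ComplexConjugate

noncomputable section

/-- The two-dimensional torus `ℝ² / ℤ²`. A function on `Torus` is the same thing as a function on
`ℝ²` that is 1-periodic in each variable. -/
abbrev Torus : Type := UnitAddTorus (Fin 2)

/-- Lebesgue measure of the unit cell, as a measure on the torus: the product of the two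
normalised Haar measures of the circle `ℝ / ℤ`. -/
abbrev cellMeasure : Measure Torus := Measure.pi fun _ : Fin 2 => AddCircle.haarAddCircle

/-- Rotation by `π/2`, `(x₁, x₂) ↦ (-x₂, x₁)`, acting on the torus. -/
def rotQuarter (x : Torus) : Torus := ![-x 1, x 0]

/-- Smoothness of a function on the torus: its periodic lift to `ℝ²` is `C^∞`. -/
def SmoothPeriodic (φ : Torus → ℂ) : Prop :=
  ContDiff ℝ ∞ (fun y : Fin 2 → ℝ => φ (fun i => (y i : UnitAddCircle)))

/-- Classical partial derivative `∂_j φ` of a function on the torus. -/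
def partialDeriv (j : Fin 2) (φ : Torus → ℂ) (x : Torus) : ℂ :=
  deriv (fun t : ℝ => φ (x + Pi.single j (t : UnitAddCircle))) 0

/-- `u` belongs to the periodic Sobolev space `H¹` (functions of `L²` whose weak gradient is
in `L²`) and `p` is its weak gradient. -/
structure IsH1WithGrad (u : Torus → ℂ) (p : Fin 2 → Torus → ℂ) : Prop where
  memLp : MemLp u 2 cellMeasure
  memLp_grad : ∀ j, MemLp (p j) 2 cellMeasure
  weak_grad : ∀ (j : Fin 2) (φ : Torus → ℂ), SmoothPeriodic φ →
    ∫ x, u x * partialDeriv j φ x ∂cellMeasure = -∫ x, p j x * φ x ∂cellMeasure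

/-- The cell average `⟨μ⟩`. -/
def cellMean (μ : Torus → ℝ) : ℝ := ∫ x, μ x ∂cellMeasure

/-- Weak form of `(𝒞₀ u, v)` for `𝒞₀ u = -∇·μ∇u`; here `p = ∇u` and `q = ∇v`. -/
def formC0 (μ : Torus → ℝ) (p q : Fin 2 → Torus → ℂ) : ℂ :=
  ∫ x, (μ x : ℂ) * (∑ j, p j x * conj (q j x)) ∂cellMeasure

/-- Weak form of `(𝒞₁ u, v)` for `𝒞₁ u = -i κ·μ∇u - i ∇·(μ κ u)`; here `p = ∇u` and `q = ∇v`. -/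
def formC1 (μ : Torus → ℝ) (κ : EuclideanSpace ℝ (Fin 2))
    (u : Torus → ℂ) (p : Fin 2 → Torus → ℂ) (v : Torus → ℂ) (q : Fin 2 → Torus → ℂ) : ℂ :=
  (∫ x, -Complex.I * (μ x : ℂ) * (∑ j, (κ j : ℂ) * p j x) * conj (v x) ∂cellMeasure) +
    ∫ x, Complex.I * (μ x : ℂ) * u x * (∑ j, (κ j : ℂ) * conj (q j x)) ∂cellMeasure

/-- `w` (with weak gradient `p`) is a preimage `𝒞₀⁻¹ 𝒞₁ u₁`, `u₁ ≡ 1`: it is an `H¹` weak solution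
of `𝒞₀ w = 𝒞₁ 1` on the torus. -/
def IsCellSolution (μ : Torus → ℝ) (κ : EuclideanSpace ℝ (Fin 2))
    (w : Torus → ℂ) (p : Fin 2 → Torus → ℂ) : Prop :=
  IsH1WithGrad w p ∧
    ∀ (v : Torus → ℂ) (q : Fin 2 → Torus → ℂ), IsH1WithGrad v q →
      formC0 μ p q = formC1 μ κ 1 0 v q

/-- The effective shear coefficient
`μ_eff = ⟨μ⟩ - (𝒞₁ 𝒞₀⁻¹ 𝒞₁ u₁, u₁)`, `u₁ ≡ 1`, in the direction `κ`, where `𝒞₀⁻¹ 𝒞₁ u₁` is any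
preimage. -/
def muEff (μ : Torus → ℝ) (κ : EuclideanSpace ℝ (Fin 2)) : ℝ :=
  let w := Classical.epsilon
    (fun w : (Torus → ℂ) × (Fin 2 → Torus → ℂ) => IsCellSolution μ κ w.1 w.2)
  cellMean μ - (formC1 μ κ w.1 w.2 1 0).re

/-- The harmonics `g = (g₁, g₂) ∈ ℤ²` with `|g₁|, |g₂| ≤ N`; there are `(2N+1)²` of them. -/
abbrev Harmonic (N : ℕ) : Type :=
  {g : Fin 2 → ℤ // g ∈ Fintype.piFinset (fun _ : Fin 2 => Finset.Icc (-(N : ℤ)) (N : ℤ))}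

/-- Fourier coefficient `μ̂(g) = ∫ μ(x) e^{-2πi g·x} dx` over the unit cell. -/
def fourierHat (μ : Torus → ℝ) (g : Fin 2 → ℤ) : ℂ :=
  UnitAddTorus.mFourierCoeff (fun x => (μ x : ℂ)) g

/-- The matrix `𝒞_{NN,0} = (μ̂(g - g') g·g')`. -/
def pweMatrix (μ : Torus → ℝ) (N : ℕ) : Matrix (Harmonic N) (Harmonic N) ℂ :=
  Matrix.of fun g g' =>
    fourierHat μ (g.1 - g'.1) * ((∑ j, g.1 j * g'.1 j : ℤ) : ℂ)

/-- The vector `f_{NN} = (μ̂(g) g₁)`. -/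
def pweVector (μ : Torus → ℝ) (N : ℕ) : Harmonic N → ℂ :=
  fun g => fourierHat μ g.1 * ((g.1 0 : ℤ) : ℂ)

/-- `μ_{NN}(μ) = ⟨μ⟩ - f_{NN} · 𝒞_{NN,0}⁻¹ f_{NN}`, where `𝒞_{NN,0}⁻¹ f_{NN}` is any preimage of
`f_{NN}` under `𝒞_{NN,0}`. -/
def muNN (μ : Torus → ℝ) (N : ℕ) : ℝ :=
  let ξ := Classical.epsilon (fun ξ : Harmonic N → ℂ => pweMatrix μ N *ᵥ ξ = pweVector μ N)
  cellMean μ - (star (pweVector μ N) ⬝ᵥ ξ).re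

/-- `μ̃_{NN}(μ) = 1 / μ_{NN}(μ⁻¹)`. -/
def muTildeNN (μ : Torus → ℝ) (N : ℕ) : ℝ := 1 / muNN (fun x => (μ x)⁻¹) N

end

/-! The proof reads the plane-wave expansion as a Galerkin method. After multiplication of fields by
`√μ`, the matrix is the Gram matrix of the weighted mode gradients, the vector collects their inner
products with the weighted constant field `√μ e₁`, and `⟨μ⟩` is the squared norm of that field.
Hence `muNN` is the squared distance from `√μ e₁` to a finite-dimensional space
(`IsElliptic.muNN_eq`). These spaces grow with `N`, so the distances decrease and tend to the
distance to the closure of their union. They stay positive because a nonzero constant field is not a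
periodic gradient.

The limiting projection yields the corrector `p` of `e₁`: `p` is a gradient and the flux `μ (e₁ -
p)` is divergence free. The squared distance is the energy of `e₁ - p`, hence the first component of
its mean flux. The map from mean field to mean flux is real, symmetric and commutes with the quarter
turn, so it is a scalar (`IsCorrector.meanFlux_isotropic`). This makes `muEff` independent of `κ`
and equal to that limit (`IsElliptic.muEff_eq`).

The lower bound comes from planar duality. A quarter turn exchanges divergence-free and curl-free
fields, so the turned flux of the medium `μ` is an admissible field of the medium `1/μ`
(`IsCorrector.dual`). Together with isotropy this gives Keller's relation: the effective
coefficients of `μ` and `1/μ` have product 1 (`meanFlux_mul_dual`). The upper bounds for `1/μ`,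
inverted, are therefore lower bounds for `μ` with the right limit. -/

noncomputable section

/-! ### Fourier coefficients and multiplication operators on `L²` -/

/-- The Hilbert space `L²` of the unit cell. -/
abbrev CellL2 : Type := Lp ℂ 2 cellMeasure

/-- The Fourier basis of the unit cell. -/
def cellBasis : HilbertBasis (Fin 2 → ℤ) ℂ CellL2 := UnitAddTorus.mFourierBasis

lemma coeFn_cellBasis (g : Fin 2 → ℤ) :
    (cellBasis g : Torus → ℂ) =ᵐ[cellMeasure] UnitAddTorus.mFourier g := by
  have h : cellBasis g = UnitAddTorus.mFourierLp 2 g :=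
    congrFun UnitAddTorus.coe_mFourierBasis g
  rw [h]
  exact UnitAddTorus.coeFn_mFourierLp 2 g

lemma inner_cell (f g : CellL2) : inner ℂ f g = ∫ x, g x * conj (f x) ∂cellMeasure := by
  rw [L2.inner_def]
  simp [RCLike.inner_apply]

/-- The Fourier coefficients of an `L²` function. -/
def cellCoeff (f : CellL2) (g : Fin 2 → ℤ) : ℂ := inner ℂ (cellBasis g) f

lemma cellCoeff_add (f f' : CellL2) (g : Fin 2 → ℤ) :
    cellCoeff (f + f') g = cellCoeff f g + cellCoeff f' g := inner_add_right _ _ _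

lemma cellCoeff_sub (f f' : CellL2) (g : Fin 2 → ℤ) :
    cellCoeff (f - f') g = cellCoeff f g - cellCoeff f' g := inner_sub_right _ _ _

lemma cellCoeff_neg (f : CellL2) (g : Fin 2 → ℤ) :
    cellCoeff (-f) g = -cellCoeff f g := inner_neg_right _ _

lemma cellCoeff_smul (c : ℂ) (f : CellL2) (g : Fin 2 → ℤ) :
    cellCoeff (c • f) g = c * cellCoeff f g := inner_smul_right _ _ _

lemma cellCoeff_zero (g : Fin 2 → ℤ) : cellCoeff 0 g = 0 := inner_zero_right _

lemma cellCoeff_cellBasis (g g' : Fin 2 → ℤ) :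
    cellCoeff (cellBasis g') g = if g = g' then 1 else 0 :=
  orthonormal_iff_ite.mp cellBasis.orthonormal g g'

lemma continuous_cellCoeff (g : Fin 2 → ℤ) : Continuous fun f => cellCoeff f g := by
  unfold cellCoeff; fun_prop

lemma cellCoeff_eq_integral (f : CellL2) (g : Fin 2 → ℤ) :
    cellCoeff f g = ∫ x, f x * conj (UnitAddTorus.mFourier g x) ∂cellMeasure := by
  rw [cellCoeff, inner_cell]
  refine integral_congr_ae ?_
  filter_upwards [coeFn_cellBasis g] with x hx
  rw [hx]

lemma cellCoeff_toLp {f : Torus → ℂ} (hf : MemLp f 2 cellMeasure) (g : Fin 2 → ℤ) :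
    cellCoeff (hf.toLp f) g = ∫ x, f x * conj (UnitAddTorus.mFourier g x) ∂cellMeasure := by
  rw [cellCoeff_eq_integral]
  refine integral_congr_ae ?_
  filter_upwards [hf.coeFn_toLp] with x hx
  rw [hx]

/-- Parseval's identity. -/
lemma hasSum_cellCoeff (f f' : CellL2) :
    HasSum (fun g => conj (cellCoeff f g) * cellCoeff f' g) (inner ℂ f f') := by
  refine (cellBasis.hasSum_inner_mul_inner f f').congr_fun fun g => ?_
  simp [cellCoeff]

lemma cell_ext {f f' : CellL2} (h : ∀ g, cellCoeff f g = cellCoeff f' g) : f = f' := by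
  apply cellBasis.repr.injective
  ext g
  rw [HilbertBasis.repr_apply_apply, HilbertBasis.repr_apply_apply]
  exact h g

/-- Multiplication by a bounded real function, as an operator of `L²`. -/
def mulCell (m : Torus → ℝ) (hm : MemLp (fun x => (m x : ℂ)) ⊤ cellMeasure) :
    CellL2 →L[ℂ] CellL2 :=
  (ContinuousLinearMap.mul ℂ ℂ).holderL cellMeasure ⊤ 2 2 (hm.toLp _)

lemma coeFn_mulCell {m : Torus → ℝ} (hm : MemLp (fun x => (m x : ℂ)) ⊤ cellMeasure) (f : CellL2) :
    (mulCell m hm f : Torus → ℂ) =ᵐ[cellMeasure] fun x => (m x : ℂ) * f x := by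
  have h := (ContinuousLinearMap.mul ℂ ℂ).coeFn_holder (r := 2) (hm.toLp _) f
  filter_upwards [h, hm.coeFn_toLp] with x hx hx'
  exact hx.trans (by simp [hx'])

lemma inner_mulCell {m : Torus → ℝ} (hm : MemLp (fun x => (m x : ℂ)) ⊤ cellMeasure)
    (f f' : CellL2) : inner ℂ (mulCell m hm f) f' = inner ℂ f (mulCell m hm f') := by
  rw [inner_cell, inner_cell]
  refine integral_congr_ae ?_
  filter_upwards [coeFn_mulCell hm f, coeFn_mulCell hm f'] with x hx hx'
  rw [hx, hx', map_mul, Complex.conj_ofReal]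
  ring

lemma mulCell_mulCell {m n k : Torus → ℝ} (hm : MemLp (fun x => (m x : ℂ)) ⊤ cellMeasure)
    (hn : MemLp (fun x => (n x : ℂ)) ⊤ cellMeasure)
    (hk : MemLp (fun x => (k x : ℂ)) ⊤ cellMeasure)
    (h : ∀ᵐ x ∂cellMeasure, m x * n x = k x) (f : CellL2) :
    mulCell m hm (mulCell n hn f) = mulCell k hk f := by
  apply Lp.ext
  filter_upwards [coeFn_mulCell hm (mulCell n hn f), coeFn_mulCell hn f, coeFn_mulCell hk f, h]
    with x h1 h2 h3 h4
  rw [h1, h2, h3, ← h4]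
  push_cast
  ring

lemma mulCell_cancel {m n : Torus → ℝ} (hm : MemLp (fun x => (m x : ℂ)) ⊤ cellMeasure)
    (hn : MemLp (fun x => (n x : ℂ)) ⊤ cellMeasure)
    (h : ∀ᵐ x ∂cellMeasure, m x * n x = 1) (f : CellL2) :
    mulCell m hm (mulCell n hn f) = f := by
  apply Lp.ext
  filter_upwards [coeFn_mulCell hm (mulCell n hn f), coeFn_mulCell hn f, h] with x h1 h2 h4
  rw [h1, h2, ← mul_assoc, ← Complex.ofReal_mul, h4]
  simp

lemma fourierHat_sub {m : Torus → ℝ} (hm : MemLp (fun x => (m x : ℂ)) ⊤ cellMeasure)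
    (g g' : Fin 2 → ℤ) :
    fourierHat m (g - g') = inner ℂ (cellBasis g) (mulCell m hm (cellBasis g')) := by
  rw [inner_cell]
  refine Eq.trans (b := ∫ x, UnitAddTorus.mFourier (-(g - g')) x * (m x : ℂ) ∂cellMeasure) rfl ?_
  refine integral_congr_ae ?_
  filter_upwards [coeFn_cellBasis g, coeFn_cellBasis g', coeFn_mulCell hm (cellBasis g')]
    with x h1 h2 h3
  rw [h3, h2, h1, ← UnitAddTorus.mFourier_neg, show -(g - g') = g' + -g by abel,
    UnitAddTorus.mFourier_add]
  ring

lemma cellMean_eq_inner {m : Torus → ℝ} (hm : MemLp (fun x => (m x : ℂ)) ⊤ cellMeasure) :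
    (cellMean m : ℂ) = inner ℂ (cellBasis 0) (mulCell m hm (cellBasis 0)) := by
  rw [← fourierHat_sub hm, sub_zero]
  refine Eq.trans (b := ∫ x, UnitAddTorus.mFourier (-0) x * (m x : ℂ) ∂cellMeasure) ?_ rfl
  rw [neg_zero, UnitAddTorus.mFourier_zero, cellMean, ← integral_complex_ofReal]
  simp

/-- The conjugate of an `L²` function has the conjugate reflected coefficients. -/
lemma cellCoeff_star (f : CellL2) (g : Fin 2 → ℤ) :
    cellCoeff (star f) g = conj (cellCoeff f (-g)) := by
  rw [cellCoeff_eq_integral, cellCoeff_eq_integral, ← integral_conj]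
  refine integral_congr_ae ?_
  filter_upwards [Lp.coeFn_star f] with x hx
  rw [hx, UnitAddTorus.mFourier_neg]
  simp

lemma mulCell_star {m : Torus → ℝ} (hm : MemLp (fun x => (m x : ℂ)) ⊤ cellMeasure) (f : CellL2) :
    mulCell m hm (star f) = star (mulCell m hm f) := by
  apply Lp.ext
  filter_upwards [coeFn_mulCell hm (star f), coeFn_mulCell hm f, Lp.coeFn_star f,
    Lp.coeFn_star (mulCell m hm f)] with x h1 h2 h3 h4
  rw [h1, h4, h3]
  simp [h2]

/-! ### Gradient and divergence-free fields -/

/-- Periodic gradients in `L²`, in terms of Fourier coefficients. -/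
def IsGradientField (p : Fin 2 → CellL2) : Prop :=
  (∀ j, cellCoeff (p j) 0 = 0) ∧
    ∀ g : Fin 2 → ℤ, (g 0 : ℂ) * cellCoeff (p 1) g = (g 1 : ℂ) * cellCoeff (p 0) g

/-- Divergence-free fields in `L²`, in terms of Fourier coefficients. -/
def IsDivFree (q : Fin 2 → CellL2) : Prop :=
  ∀ g : Fin 2 → ℤ, (g 0 : ℂ) * cellCoeff (q 0) g + (g 1 : ℂ) * cellCoeff (q 1) g = 0

/-- Helmholtz orthogonality, mode by mode through Parseval: at `g ≠ 0` the coefficient of `p` is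
parallel to `g` and that of `q` is orthogonal to `g`. At `g = 0` the coefficient of `p` vanishes. -/
lemma IsGradientField.inner_eq_zero {p q : Fin 2 → CellL2} (hp : IsGradientField p)
    (hq : IsDivFree q) : inner ℂ (p 0) (q 0) + inner ℂ (p 1) (q 1) = 0 := by
  refine ((hasSum_cellCoeff (p 0) (q 0)).add (hasSum_cellCoeff (p 1) (q 1))).unique ?_
  convert hasSum_zero using 2 with g
  have hp' := congrArg conj (hp.2 g)
  have hq' := hq g
  simp only [map_mul, map_intCast] at hp'
  by_cases h0 : g 0 = 0
  · by_cases h1 : g 1 = 0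
    · have hg : g = 0 := by ext j; fin_cases j <;> simpa
      simp [hg, hp.1]
    · have h1' : (g 1 : ℂ) ≠ 0 := by exact_mod_cast h1
      apply mul_left_cancel₀ h1'
      linear_combination conj (cellCoeff (p 1) g) * hq' - cellCoeff (q 0) g * hp'
  · have h0' : (g 0 : ℂ) ≠ 0 := by exact_mod_cast h0
    apply mul_left_cancel₀ h0'
    linear_combination conj (cellCoeff (p 0) g) * hq' + cellCoeff (q 1) g * hp'

lemma cellBasis_zero_coeff (g : Fin 2 → ℤ) (j : Fin 2) :
    (g j : ℂ) * cellCoeff (cellBasis 0) g = 0 := by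
  rw [cellCoeff_cellBasis]
  split_ifs with h <;> simp [h]

lemma cellCoeff_cellBasis_zero : cellCoeff (cellBasis 0) 0 = 1 := by simp [cellCoeff_cellBasis]

/-- `p` is the corrector of the coefficient `m` for the mean field `κ`: it is a gradient and the
flux `m (κ - p)` is divergence free. -/
structure IsCorrector (m : Torus → ℝ) (hm : MemLp (fun x => (m x : ℂ)) ⊤ cellMeasure)
    (κ : Fin 2 → ℂ) (p : Fin 2 → CellL2) : Prop where
  gradient : IsGradientField p
  divFree : IsDivFree fun j => mulCell m hm (κ j • cellBasis 0 - p j)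

/-- The mean flux of the field `κ - p`. -/
def meanFlux (m : Torus → ℝ) (hm : MemLp (fun x => (m x : ℂ)) ⊤ cellMeasure)
    (κ : Fin 2 → ℂ) (p : Fin 2 → CellL2) (j : Fin 2) : ℂ :=
  cellCoeff (mulCell m hm (κ j • cellBasis 0 - p j)) 0

/-! ### Correctors: linearity, uniqueness and energy -/

section Corrector

variable {m : Torus → ℝ} {hm : MemLp (fun x => (m x : ℂ)) ⊤ cellMeasure}
  {κ κ' : Fin 2 → ℂ} {p p' : Fin 2 → CellL2}

lemma IsCorrector.lincomb (hp : IsCorrector m hm κ p) (hp' : IsCorrector m hm κ' p') (c c' : ℂ) :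
    IsCorrector m hm (fun j => c * κ j + c' * κ' j) (fun j => c • p j + c' • p' j) where
  gradient := by
    refine ⟨fun j => ?_, fun g => ?_⟩
    · simp [cellCoeff_add, cellCoeff_smul, hp.gradient.1, hp'.gradient.1]
    · simp only [cellCoeff_add, cellCoeff_smul]
      linear_combination c * hp.gradient.2 g + c' * hp'.gradient.2 g
  divFree := by
    intro g
    have h1 := hp.divFree g
    have h2 := hp'.divFree g
    simp only [map_sub, map_add, map_smul, cellCoeff_add, cellCoeff_smul, cellCoeff_sub] at h1 h2 ⊢
    linear_combination c * h1 + c' * h2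

lemma meanFlux_lincomb (c c' : ℂ) (j : Fin 2) :
    meanFlux m hm (fun j => c * κ j + c' * κ' j) (fun j => c • p j + c' • p' j) j =
      c * meanFlux m hm κ p j + c' * meanFlux m hm κ' p' j := by
  simp only [meanFlux, map_sub, map_add, map_smul, cellCoeff_add, cellCoeff_smul, cellCoeff_sub]
  ring

lemma eq_zero_of_inner_mulCell {f : CellL2} (hpos : ∀ᵐ x ∂cellMeasure, 0 < m x)
    (h : (inner ℂ f (mulCell m hm f)).re = 0) : f = 0 := by
  have hint := (L2.integrable_inner (𝕜 := ℂ) f (mulCell m hm f)).re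
  have hre : (inner ℂ f (mulCell m hm f)).re =
      ∫ x, RCLike.re (inner ℂ (f x) (mulCell m hm f x)) ∂cellMeasure := by
    rw [integral_re (L2.integrable_inner (𝕜 := ℂ) f (mulCell m hm f)), L2.inner_def]
    rfl
  have hval : ∀ᵐ x ∂cellMeasure,
      RCLike.re (inner ℂ (f x) (mulCell m hm f x)) = m x * ‖f x‖ ^ 2 := by
    filter_upwards [coeFn_mulCell hm f] with x hx
    rw [hx, RCLike.inner_apply, mul_assoc, Complex.mul_conj']
    simp [← Complex.ofReal_pow]
  rw [hre, integral_eq_zero_iff_of_nonneg_ae ?_ hint] at h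
  · apply (Lp.eq_zero_iff_ae_eq_zero).mpr
    filter_upwards [h, hval, hpos] with x h1 h2 h3
    rw [h2] at h1
    simpa [h3.ne'] using h1
  · filter_upwards [hval, hpos] with x h2 h3
    rw [h2]
    have := h3.le
    positivity

lemma inner_mulCell_self_re_nonneg (f : CellL2) (hpos : ∀ᵐ x ∂cellMeasure, 0 < m x) :
    0 ≤ (inner ℂ f (mulCell m hm f)).re := by
  have hre : (inner ℂ f (mulCell m hm f)).re =
      ∫ x, RCLike.re (inner ℂ (f x) (mulCell m hm f x)) ∂cellMeasure := by
    rw [integral_re (L2.integrable_inner (𝕜 := ℂ) f (mulCell m hm f)), L2.inner_def]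
    rfl
  rw [hre]
  apply integral_nonneg_of_ae
  filter_upwards [coeFn_mulCell hm f, hpos] with x hx h3
  rw [hx, RCLike.inner_apply, mul_assoc, Complex.mul_conj']
  have := h3.le
  simp only [← Complex.ofReal_pow, Pi.zero_apply, RCLike.re_to_complex, ← Complex.ofReal_mul,
    Complex.ofReal_re]
  positivity

/-- Correctors are unique. -/
lemma IsCorrector.unique (hpos : ∀ᵐ x ∂cellMeasure, 0 < m x) (hp : IsCorrector m hm κ p)
    (hp' : IsCorrector m hm κ p') : p = p' := by
  have h := hp.lincomb hp' 1 (-1)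
  -- The mean fields cancel in the difference, so `p - p'` is a gradient and `m (p - p')` is
  -- divergence free. Their orthogonality says that the energy of `p - p'` is zero.
  have hd : IsDivFree fun j => mulCell m hm ((1 : ℂ) • p j + (-1 : ℂ) • p' j) := by
    intro g
    have := h.divFree g
    simp only [one_mul, neg_mul, add_neg_cancel, zero_smul, zero_sub, map_neg, cellCoeff_neg]
      at this
    linear_combination -this
  have h0 := congrArg Complex.re (h.gradient.inner_eq_zero hd)
  rw [Complex.add_re, Complex.zero_re] at h0
  have hn0 := inner_mulCell_self_re_nonneg (hm := hm) ((1 : ℂ) • p 0 + (-1 : ℂ) • p' 0) hpos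
  have hn1 := inner_mulCell_self_re_nonneg (hm := hm) ((1 : ℂ) • p 1 + (-1 : ℂ) • p' 1) hpos
  have e0 := eq_zero_of_inner_mulCell (hm := hm) (f := (1 : ℂ) • p 0 + (-1 : ℂ) • p' 0) hpos
    (by linarith)
  have e1 := eq_zero_of_inner_mulCell (hm := hm) (f := (1 : ℂ) • p 1 + (-1 : ℂ) • p' 1) hpos
    (by linarith)
  funext j
  rw [one_smul, neg_one_smul, ← sub_eq_add_neg, sub_eq_zero] at e0 e1
  fin_cases j <;> assumption

/-- The effective sesquilinear form, through the energy. -/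
lemma IsCorrector.meanFlux_eq_energy (hp : IsCorrector m hm κ p) (hp' : IsCorrector m hm κ' p') :
    conj (κ' 0) * meanFlux m hm κ p 0 + conj (κ' 1) * meanFlux m hm κ p 1 =
      inner ℂ (κ' 0 • cellBasis 0 - p' 0) (mulCell m hm (κ 0 • cellBasis 0 - p 0)) +
      inner ℂ (κ' 1 • cellBasis 0 - p' 1) (mulCell m hm (κ 1 • cellBasis 0 - p 1)) := by
  -- The gradient `p'` is orthogonal to the flux, so only its constant part `κ'` contributes, and
  -- that part sees only the mean of the flux.
  have h := hp'.gradient.inner_eq_zero hp.divFree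
  rw [inner_sub_left, inner_sub_left, inner_smul_left, inner_smul_left]
  simp only [meanFlux, cellCoeff]
  linear_combination h

/-- The effective matrix is Hermitian because multiplication by the real function `m` is
self-adjoint. -/
lemma IsCorrector.meanFlux_conj_symm (hp : IsCorrector m hm κ p)
    (hp' : IsCorrector m hm κ' p') :
    conj (κ' 0) * meanFlux m hm κ p 0 + conj (κ' 1) * meanFlux m hm κ p 1 =
      conj (conj (κ 0) * meanFlux m hm κ' p' 0 + conj (κ 1) * meanFlux m hm κ' p' 1) := by
  rw [hp.meanFlux_eq_energy hp', hp'.meanFlux_eq_energy hp, map_add, inner_conj_symm,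
    inner_conj_symm, inner_mulCell, inner_mulCell]

/-! ### Symmetries of the corrector -/

lemma star_smul_basis_sub (c : ℂ) (f : CellL2) :
    conj c • cellBasis 0 - star f = star (c • cellBasis 0 - f) := by
  apply cell_ext
  intro g
  simp only [cellCoeff_sub, cellCoeff_star, cellCoeff_smul, cellCoeff_cellBasis, neg_eq_zero,
    map_sub, map_mul]
  split_ifs <;> simp

/-- Since `m` is real, conjugation preserves the corrector equations. With uniqueness, this makes
the flux of a real mean field real. -/
lemma IsCorrector.star (hp : IsCorrector m hm κ p) :
    IsCorrector m hm (fun j => conj (κ j)) (fun j => star (p j)) where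
  gradient := by
    refine ⟨fun j => ?_, fun g => ?_⟩
    · simp [cellCoeff_star, hp.gradient.1]
    · have := congrArg conj (hp.gradient.2 (-g))
      simp only [map_mul, Pi.neg_apply, Int.cast_neg, map_neg, map_intCast] at this
      simp only [cellCoeff_star]
      linear_combination -this
  divFree := by
    intro g
    have := congrArg conj (hp.divFree (-g))
    simp only [map_mul, map_add, Pi.neg_apply, Int.cast_neg, map_neg, map_intCast, map_zero]
      at this
    simp only [star_smul_basis_sub, mulCell_star, cellCoeff_star]
    linear_combination -this

lemma meanFlux_star (j : Fin 2) :
    meanFlux m hm (fun j => conj (κ j)) (fun j => star (p j)) j = conj (meanFlux m hm κ p j) := by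
  simp only [meanFlux, star_smul_basis_sub, mulCell_star, cellCoeff_star, neg_zero]

/-- The rotation of the torus by `π/2`, as a homomorphism. -/
def rotQuarterHom : Torus →+ Torus where
  toFun := rotQuarter
  map_zero' := by ext j; fin_cases j <;> simp [rotQuarter]
  map_add' x y := by ext j; fin_cases j <;> simp [rotQuarter, add_comm]

lemma continuous_rotQuarter : Continuous rotQuarter := by
  refine continuous_pi fun j => ?_
  fin_cases j
  · exact (continuous_apply 1).neg
  · exact continuous_apply 0

/-- A continuous surjective homomorphism of compact groups carries Haar measure to Haar measure of
the same total mass. -/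
lemma measurePreserving_rotQuarter : MeasurePreserving rotQuarter cellMeasure cellMeasure :=
  AddMonoidHom.measurePreserving (f := rotQuarterHom) continuous_rotQuarter
    (fun x => ⟨![x 1, -x 0], by ext j; fin_cases j <;> simp [rotQuarterHom, rotQuarter]⟩) rfl

/-- Composition with the rotation by `π/2`, as an isometry of `L²`. -/
def rotCell : CellL2 →ₗᵢ[ℂ] CellL2 :=
  Lp.compMeasurePreservingₗᵢ ℂ rotQuarter measurePreserving_rotQuarter

lemma coeFn_rotCell (f : CellL2) :
    (rotCell f : Torus → ℂ) =ᵐ[cellMeasure] fun x => f (rotQuarter x) :=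
  Lp.coeFn_compMeasurePreserving f measurePreserving_rotQuarter

/-- With `R` the quarter turn, `(R g) · (R x) = g · x`, so the mode `R g` composed with `R` is the
mode `g`. -/
lemma rotCell_cellBasis (g : Fin 2 → ℤ) : rotCell (cellBasis ![-g 1, g 0]) = cellBasis g := by
  apply Lp.ext
  filter_upwards [coeFn_rotCell (cellBasis ![-g 1, g 0]), coeFn_cellBasis g,
    measurePreserving_rotQuarter.quasiMeasurePreserving.ae (coeFn_cellBasis ![-g 1, g 0])]
    with x h1 h2 h3
  rw [h1, h2, h3]
  simp [UnitAddTorus.mFourier, rotQuarter, mul_comm, -fourier_apply, fourier_apply]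

lemma cellCoeff_rotCell (f : CellL2) (g : Fin 2 → ℤ) :
    cellCoeff (rotCell f) g = cellCoeff f ![-g 1, g 0] := by
  rw [cellCoeff, ← rotCell_cellBasis g, rotCell.inner_map_map, cellCoeff]

lemma rotCell_cellBasis_zero : rotCell (cellBasis 0) = cellBasis 0 := by
  have h := rotCell_cellBasis 0
  have h0 : ![-(0 : Fin 2 → ℤ) 1, (0 : Fin 2 → ℤ) 0] = 0 := by ext j; fin_cases j <;> simp
  rwa [h0] at h

lemma mulCell_rotCell (hsymm : ∀ x, m (rotQuarter x) = m x) (f : CellL2) :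
    mulCell m hm (rotCell f) = rotCell (mulCell m hm f) := by
  apply Lp.ext
  filter_upwards [coeFn_mulCell hm (rotCell f), coeFn_rotCell f, coeFn_rotCell (mulCell m hm f),
    measurePreserving_rotQuarter.quasiMeasurePreserving.ae (coeFn_mulCell hm f)] with x h1 h2 h3 h4
  rw [h1, h2, h3, h4, hsymm]

lemma rotCell_smul_basis_sub (c : ℂ) (f : CellL2) :
    c • cellBasis 0 - rotCell f = rotCell (c • cellBasis 0 - f) := by
  rw [map_sub, map_smul, rotCell_cellBasis_zero]

lemma cellCoeff_rotCell_zero (f : CellL2) : cellCoeff (rotCell f) 0 = cellCoeff f 0 := by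
  rw [cellCoeff, ← rotCell_cellBasis_zero, rotCell.inner_map_map, cellCoeff]

lemma rot_field_zero (κ : Fin 2 → ℂ) (p : Fin 2 → CellL2) :
    (![κ 1, -κ 0] : Fin 2 → ℂ) 0 • cellBasis 0 -
      (![rotCell (p 1), rotCell (-p 0)] : Fin 2 → CellL2) 0 =
    rotCell (κ 1 • cellBasis 0 - p 1) := by
  simp [rotCell_smul_basis_sub]

lemma rot_field_one (κ : Fin 2 → ℂ) (p : Fin 2 → CellL2) :
    (![κ 1, -κ 0] : Fin 2 → ℂ) 1 • cellBasis 0 -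
      (![rotCell (p 1), rotCell (-p 0)] : Fin 2 → CellL2) 1 =
    -rotCell (κ 0 • cellBasis 0 - p 0) := by
  rw [Matrix.cons_val_one, Matrix.cons_val_one, Matrix.cons_val_zero, Matrix.cons_val_zero,
    rotCell_smul_basis_sub, ← map_neg]
  congr 1
  module

/-- A vector field `F` is transported to `x ↦ R⁻¹ F (R x)`, where `R⁻¹ (y₀, y₁) = (y₁, -y₀)`. This
preserves gradients and divergence-free fields, and it commutes with multiplication by the
`R`-invariant `m`. -/
lemma IsCorrector.rot (hsymm : ∀ x, m (rotQuarter x) = m x) (hp : IsCorrector m hm κ p) :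
    IsCorrector m hm ![κ 1, -κ 0] ![rotCell (p 1), rotCell (-p 0)] where
  gradient := by
    refine ⟨fun j => ?_, fun g => ?_⟩
    · fin_cases j <;>
        simp [cellCoeff_rotCell_zero, cellCoeff_neg, hp.gradient.1, -map_neg]
    · have := hp.gradient.2 ![-g 1, g 0]
      simp only [Matrix.cons_val_zero, Matrix.cons_val_one, cellCoeff_rotCell, cellCoeff_neg,
        Int.cast_neg] at this ⊢
      linear_combination this
  divFree := by
    intro g
    have := hp.divFree ![-g 1, g 0]
    simp only [Matrix.cons_val_zero, Matrix.cons_val_one, Int.cast_neg] at this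
    beta_reduce
    rw [rot_field_zero, rot_field_one, map_neg, cellCoeff_neg, mulCell_rotCell hsymm,
      mulCell_rotCell hsymm, cellCoeff_rotCell, cellCoeff_rotCell]
    linear_combination this

lemma meanFlux_rot_zero (hsymm : ∀ x, m (rotQuarter x) = m x) :
    meanFlux m hm ![κ 1, -κ 0] ![rotCell (p 1), rotCell (-p 0)] 0 = meanFlux m hm κ p 1 := by
  rw [meanFlux, rot_field_zero, mulCell_rotCell hsymm, cellCoeff_rotCell_zero, meanFlux]

lemma meanFlux_rot_one (hsymm : ∀ x, m (rotQuarter x) = m x) :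
    meanFlux m hm ![κ 1, -κ 0] ![rotCell (p 1), rotCell (-p 0)] 1 = -meanFlux m hm κ p 0 := by
  rw [meanFlux, rot_field_one, map_neg, cellCoeff_neg, mulCell_rotCell hsymm,
    cellCoeff_rotCell_zero, meanFlux]

/-- Isotropy: under cubic symmetry the mean flux is a real multiple of the mean field. -/
lemma IsCorrector.meanFlux_isotropic (hpos : ∀ᵐ x ∂cellMeasure, 0 < m x)
    (hsymm : ∀ x, m (rotQuarter x) = m x) (hp : IsCorrector m hm ![1, 0] p) {κ : Fin 2 → ℂ}
    {q : Fin 2 → CellL2} (hq : IsCorrector m hm κ q) (j : Fin 2) :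
    meanFlux m hm κ q j = ((meanFlux m hm ![1, 0] p 0).re : ℂ) * κ j := by
  have hreal : ∀ j, conj (meanFlux m hm ![1, 0] p j) = meanFlux m hm ![1, 0] p j := by
    intro j
    have hs := hp.star
    rw [← meanFlux_star]
    have hv : (fun j => conj ((![1, 0] : Fin 2 → ℂ) j)) = ![1, 0] := by
      ext j; fin_cases j <;> simp
    rw [hv] at hs ⊢
    rw [hs.unique hpos hp]
  have hr := hp.rot hsymm
  have hr0 := meanFlux_rot_zero (hm := hm) (κ := ![1, 0]) (p := p) hsymm
  have hr1 := meanFlux_rot_one (hm := hm) (κ := ![1, 0]) (p := p) hsymm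
  -- The mean field `(0, -1)` has flux `(c₁, -c₀)`, where `c` is the flux of `(1, 0)`. Symmetry of
  -- the effective matrix then reads `-c₁ = c₁`.
  have h1 : meanFlux m hm ![1, 0] p 1 = 0 := by
    have := hp.meanFlux_conj_symm hr
    rw [hr0, hr1] at this
    simp [hreal] at this
    have h2 : (2 : ℂ) * meanFlux m hm ![1, 0] p 1 = 0 := by linear_combination -this
    simpa using h2
  have hre : ((meanFlux m hm ![1, 0] p 0).re : ℂ) = meanFlux m hm ![1, 0] p 0 :=
    Complex.conj_eq_iff_re.mp (hreal 0)
  -- By linearity `κ = κ₀ (1, 0) - κ₁ (0, -1)` reduces every mean field to these two.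
  have hc := hp.lincomb hr (κ 0) (-κ 1)
  have hv : (fun j => κ 0 * (![1, 0] : Fin 2 → ℂ) j +
      -κ 1 * (![(![1, 0] : Fin 2 → ℂ) 1, -(![1, 0] : Fin 2 → ℂ) 0] : Fin 2 → ℂ) j) = κ := by
    ext j; fin_cases j <;> simp
  have hf := meanFlux_lincomb (m := m) (hm := hm) (κ := ![1, 0]) (p := p)
    (κ' := ![(![1, 0] : Fin 2 → ℂ) 1, -(![1, 0] : Fin 2 → ℂ) 0])
    (p' := ![rotCell (p 1), rotCell (-p 0)]) (κ 0) (-κ 1) j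
  rw [hv] at hc hf
  rw [hq.unique hpos hc, hf, hre]
  fin_cases j
  · simp only [Fin.zero_eta, hr0, h1]; ring
  · simp only [Fin.mk_one, hr1, h1]; ring

/-! ### Duality -/

/-- The quarter turn of the flux is the field of the reciprocal medium. -/
lemma IsCorrector.dual (hp : IsCorrector m hm κ p) {n : Torus → ℝ}
    (hn : MemLp (fun x => (n x : ℂ)) ⊤ cellMeasure) (hnm : ∀ᵐ x ∂cellMeasure, n x * m x = 1) :
    ∃ q, IsCorrector n hn ![meanFlux m hm κ p 1, -meanFlux m hm κ p 0] q ∧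
      meanFlux n hn ![meanFlux m hm κ p 1, -meanFlux m hm κ p 0] q 0 = κ 1 ∧
      meanFlux n hn ![meanFlux m hm κ p 1, -meanFlux m hm κ p 0] q 1 = -κ 0 := by
  set F : Fin 2 → CellL2 := fun j => mulCell m hm (κ j • cellBasis 0 - p j) with hF
  have hG : ∀ j, mulCell n hn (F j) = κ j • cellBasis 0 - p j := fun j =>
    mulCell_cancel hn hm hnm _
  have hdiv := hp.divFree
  have hgr := hp.gradient
  set c := meanFlux m hm κ p with hc
  have hcF : ∀ j, cellCoeff (F j) 0 = c j := fun j => rfl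
  have e0 : (![c 1, -c 0] : Fin 2 → ℂ) 0 • cellBasis 0 -
      (![c 1 • cellBasis 0 - F 1, F 0 - c 0 • cellBasis 0] : Fin 2 → CellL2) 0 = F 1 := by simp
  have e1 : (![c 1, -c 0] : Fin 2 → ℂ) 1 • cellBasis 0 -
      (![c 1 • cellBasis 0 - F 1, F 0 - c 0 • cellBasis 0] : Fin 2 → CellL2) 1 = -F 0 := by
    rw [Matrix.cons_val_one, Matrix.cons_val_one, Matrix.cons_val_zero, Matrix.cons_val_zero]
    module
  -- The new field is the turned flux `(F₁, -F₀)`, with mean `(c₁, -c₀)`; the witness is this mean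
  -- minus the field. Zero divergence of `F` makes the witness curl free. Multiplication by `n`
  -- returns the turned original field, which is divergence free because `p` is curl free.
  refine ⟨![c 1 • cellBasis 0 - F 1, F 0 - c 0 • cellBasis 0], ⟨⟨fun j => ?_, fun g => ?_⟩, ?_⟩,
    ?_, ?_⟩
  · fin_cases j <;> simp [cellCoeff_sub, cellCoeff_smul, cellCoeff_cellBasis_zero, hcF]
  · have h := hdiv g
    have b0 := cellBasis_zero_coeff g 0
    have b1 := cellBasis_zero_coeff g 1
    simp only [Matrix.cons_val_zero, Matrix.cons_val_one, cellCoeff_sub, cellCoeff_smul]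
    linear_combination h - c 0 * b0 - c 1 * b1
  · intro g
    have b0 := cellBasis_zero_coeff g 0
    have b1 := cellBasis_zero_coeff g 1
    have h := hgr.2 g
    beta_reduce
    rw [e0, e1, map_neg, hG, hG, cellCoeff_neg, cellCoeff_sub, cellCoeff_sub, cellCoeff_smul,
      cellCoeff_smul]
    linear_combination κ 1 * b0 - κ 0 * b1 - h
  · rw [meanFlux, e0, hG, cellCoeff_sub, cellCoeff_smul, cellCoeff_cellBasis_zero, hgr.1]
    ring
  · rw [meanFlux, e1, map_neg, hG, cellCoeff_neg, cellCoeff_sub, cellCoeff_smul,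
      cellCoeff_cellBasis_zero, hgr.1]
    ring

/-- Keller's reciprocity relation for media with cubic symmetry. -/
lemma meanFlux_mul_dual (hpos : ∀ᵐ x ∂cellMeasure, 0 < m x)
    (hsymm : ∀ x, m (rotQuarter x) = m x) (hp : IsCorrector m hm ![1, 0] p) {n : Torus → ℝ}
    (hn : MemLp (fun x => (n x : ℂ)) ⊤ cellMeasure) (hnm : ∀ᵐ x ∂cellMeasure, n x * m x = 1)
    (hnsymm : ∀ x, n (rotQuarter x) = n x) {q : Fin 2 → CellL2}
    (hq : IsCorrector n hn ![1, 0] q) :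
    (meanFlux m hm ![1, 0] p 0).re * (meanFlux n hn ![1, 0] q 0).re = 1 := by
  have hnpos : ∀ᵐ x ∂cellMeasure, 0 < n x := by
    filter_upwards [hpos, hnm] with x h1 h2
    by_contra! h
    nlinarith
  -- With `α` and `β` the coefficients of `m` and `n`, the dual mean field is `(0, -α)` and its flux
  -- is `(0, -1)`. Isotropy of `n` in the second component gives `-1 = -αβ`.
  obtain ⟨r, hr, -, hr1⟩ := hp.dual hn hnm
  rw [hq.meanFlux_isotropic hnpos hnsymm hr 1] at hr1
  have h0 := hp.meanFlux_isotropic hpos hsymm hp 0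
  simp only [Matrix.cons_val_one, Matrix.cons_val_zero, mul_one] at hr1 h0
  rw [h0] at hr1
  have : (((meanFlux m hm ![1, 0] p 0).re * (meanFlux n hn ![1, 0] q 0).re : ℝ) : ℂ) = 1 := by
    push_cast
    linear_combination -hr1
  exact_mod_cast this

end Corrector

/-! ### Galerkin projections in a Hilbert space -/

section Galerkin

variable {E : Type*} [NormedAddCommGroup E] [InnerProductSpace ℂ E]

lemma norm_sub_starProjection_le (K : Submodule ℂ E) [K.HasOrthogonalProjection] (x : E) {w : E}
    (hw : w ∈ K) : ‖x - K.starProjection x‖ ≤ ‖x - w‖ := by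
  rw [Submodule.starProjection_minimal]
  exact ciInf_le ⟨0, Set.forall_mem_range.mpr fun _ => norm_nonneg _⟩ (⟨w, hw⟩ : K)

lemma inner_sub_starProjection (K : Submodule ℂ E) [K.HasOrthogonalProjection] (x : E) :
    inner ℂ x x - inner ℂ x (K.starProjection x) = ((‖x - K.starProjection x‖ ^ 2 : ℝ) : ℂ) := by
  have h : inner ℂ (K.starProjection x) (x - K.starProjection x) = 0 :=
    inner_eq_zero_symm.mp
      (K.starProjection_inner_eq_zero x _ (K.starProjection_apply_mem x))
  have h2 := inner_self_eq_norm_sq_to_K (𝕜 := ℂ) (x - K.starProjection x)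
  rw [inner_sub_left, h, sub_zero, inner_sub_right] at h2
  rw [h2]
  push_cast
  rfl

variable {ι : Type*} [Fintype ι]

lemma gram_mulVec (y : ι → E) (ξ : ι → ℂ) (i : ι) :
    ((Matrix.of fun i j => inner ℂ (y i) (y j)) *ᵥ ξ) i = inner ℂ (y i) (∑ j, ξ j • y j) := by
  simp [Matrix.mulVec, dotProduct, mul_comm]

/-- The Gram matrix may be singular (the mode `g = 0` has zero gradient), yet the normal equations
are solvable: the orthogonal projection of `x` onto the span has coordinates, and these solve them.
-/
lemma exists_gram_solution (y : ι → E) (x : E) :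
    ∃ ξ : ι → ℂ, (Matrix.of fun i j => inner ℂ (y i) (y j)) *ᵥ ξ = fun i => inner ℂ (y i) x := by
  have : FiniteDimensional ℂ (Submodule.span ℂ (Set.range y)) :=
    FiniteDimensional.span_of_finite ℂ (Set.finite_range y)
  obtain ⟨ξ, hξ⟩ := (Submodule.mem_span_range_iff_exists_fun ℂ).mp
    ((Submodule.span ℂ (Set.range y)).starProjection_apply_mem x)
  refine ⟨ξ, funext fun i => ?_⟩
  rw [gram_mulVec, hξ]
  have h := inner_eq_zero_symm.mp
    ((Submodule.span ℂ (Set.range y)).starProjection_inner_eq_zero x (y i)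
      (Submodule.subset_span ⟨i, rfl⟩))
  rw [inner_sub_right, sub_eq_zero] at h
  exact h.symm

/-- The normal equations say that the residual is orthogonal to every `y i`. The combination is thus
the same for all preimages, which is why their choice does not matter. -/
lemma sum_eq_starProjection_of_gram (y : ι → E) (x : E)
    [(Submodule.span ℂ (Set.range y)).HasOrthogonalProjection] {ξ : ι → ℂ}
    (hξ : (Matrix.of fun i j => inner ℂ (y i) (y j)) *ᵥ ξ = fun i => inner ℂ (y i) x) :
    ∑ j, ξ j • y j = (Submodule.span ℂ (Set.range y)).starProjection x := by
  refine (Submodule.eq_starProjection_of_mem_of_inner_eq_zero ?_ fun w hw => ?_).symm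
  · exact Submodule.sum_mem _ fun j _ => Submodule.smul_mem _ _ (Submodule.subset_span ⟨j, rfl⟩)
  · induction hw using Submodule.span_induction with
    | mem w hw =>
      obtain ⟨i, rfl⟩ := hw
      rw [inner_eq_zero_symm, inner_sub_right, ← gram_mulVec, hξ, sub_self]
    | zero => simp
    | add v w _ _ hv hw => rw [inner_add_right, hv, hw, add_zero]
    | smul c v _ hv => rw [inner_smul_right, hv, mul_zero]

lemma gram_quadratic (y : ι → E) (x : E)
    [(Submodule.span ℂ (Set.range y)).HasOrthogonalProjection] {ξ : ι → ℂ}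
    (hξ : (Matrix.of fun i j => inner ℂ (y i) (y j)) *ᵥ ξ = fun i => inner ℂ (y i) x) :
    inner ℂ x x - (star fun i => inner ℂ (y i) x) ⬝ᵥ ξ =
      ((‖x - (Submodule.span ℂ (Set.range y)).starProjection x‖ ^ 2 : ℝ) : ℂ) := by
  rw [← inner_sub_starProjection, ← sum_eq_starProjection_of_gram y x hξ, inner_sum]
  congr 1
  refine Finset.sum_congr rfl fun i _ => ?_
  rw [inner_smul_right, Pi.star_apply, mul_comm, ← inner_conj_symm x (y i)]
  rfl

end Galerkin

/-! ### Bounded elliptic coefficients -/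

/-- Positive coefficients that are bounded together with their reciprocals. -/
structure IsElliptic (m : Torus → ℝ) : Prop where
  pos : ∀ᵐ x ∂cellMeasure, 0 < m x
  memLp : MemLp (fun x => (m x : ℂ)) ⊤ cellMeasure
  memLp_sqrt : MemLp (fun x => ((√(m x) : ℝ) : ℂ)) ⊤ cellMeasure
  memLp_inv_sqrt : MemLp (fun x => (((√(m x))⁻¹ : ℝ) : ℂ)) ⊤ cellMeasure

lemma isElliptic_of_bounds {m : Torus → ℝ} (hmeas : AEMeasurable m cellMeasure) {a b : ℝ}
    (ha : 0 < a) (hab : ∀ᵐ x ∂cellMeasure, a ≤ m x ∧ m x ≤ b) : IsElliptic m where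
  pos := hab.mono fun x hx => ha.trans_le hx.1
  memLp := by
    refine memLp_top_of_bound
      (Complex.measurable_ofReal.comp_aemeasurable hmeas).aestronglyMeasurable b ?_
    filter_upwards [hab] with x hx
    rw [Complex.norm_real, Real.norm_of_nonneg (ha.le.trans hx.1)]
    exact hx.2
  memLp_sqrt := by
    refine memLp_top_of_bound
      (Complex.measurable_ofReal.comp_aemeasurable hmeas.sqrt).aestronglyMeasurable (√b) ?_
    filter_upwards [hab] with x hx
    rw [Complex.norm_real, Real.norm_of_nonneg (Real.sqrt_nonneg _)]
    exact Real.sqrt_le_sqrt hx.2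
  memLp_inv_sqrt := by
    refine memLp_top_of_bound
      (Complex.measurable_ofReal.comp_aemeasurable hmeas.sqrt.inv).aestronglyMeasurable
      (√a)⁻¹ ?_
    filter_upwards [hab] with x hx
    rw [Complex.norm_real, Real.norm_of_nonneg (inv_nonneg.mpr (Real.sqrt_nonneg _))]
    exact inv_anti₀ (Real.sqrt_pos.mpr ha) (Real.sqrt_le_sqrt hx.1)

lemma IsElliptic.sqrt_mul_sqrt {m : Torus → ℝ} (h : IsElliptic m) :
    ∀ᵐ x ∂cellMeasure, √(m x) * √(m x) = m x :=
  h.pos.mono fun _ hx => Real.mul_self_sqrt hx.le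

lemma IsElliptic.inv_sqrt_mul_sqrt {m : Torus → ℝ} (h : IsElliptic m) :
    ∀ᵐ x ∂cellMeasure, (√(m x))⁻¹ * √(m x) = 1 :=
  h.pos.mono fun _ hx => inv_mul_cancel₀ (Real.sqrt_pos.mpr hx).ne'

lemma IsElliptic.sqrt_mul_inv_sqrt {m : Torus → ℝ} (h : IsElliptic m) :
    ∀ᵐ x ∂cellMeasure, √(m x) * (√(m x))⁻¹ = 1 :=
  h.pos.mono fun _ hx => mul_inv_cancel₀ (Real.sqrt_pos.mpr hx).ne'

/-! ### Fields on the unit cell -/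

/-- The Hilbert space of square integrable fields. -/
abbrev CellField : Type := PiLp 2 fun _ : Fin 2 => CellL2

lemma inner_field (p q : CellField) :
    inner ℂ p q = inner ℂ (p 0) (q 0) + inner ℂ (p 1) (q 1) := by
  rw [PiLp.inner_apply, Fin.sum_univ_two]

/-- Multiplication of fields by a bounded function. -/
def mulField (m : Torus → ℝ) (hm : MemLp (fun x => (m x : ℂ)) ⊤ cellMeasure) :
    CellField →L[ℂ] CellField :=
  (PiLp.continuousLinearEquiv 2 ℂ fun _ : Fin 2 => CellL2).symm.toContinuousLinearMap ∘L
    (ContinuousLinearMap.pi fun j => mulCell m hm ∘L ContinuousLinearMap.proj j) ∘L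
    (PiLp.continuousLinearEquiv 2 ℂ fun _ : Fin 2 => CellL2).toContinuousLinearMap

lemma mulField_apply {m : Torus → ℝ} (hm : MemLp (fun x => (m x : ℂ)) ⊤ cellMeasure)
    (p : CellField) (j : Fin 2) : mulField m hm p j = mulCell m hm (p j) := rfl

/-- The weight `√m` turns the energy product into the standard one, so that energy minimisation
becomes orthogonal projection in `CellField`. -/
lemma IsElliptic.inner_sqrt_sqrt {m : Torus → ℝ} (h : IsElliptic m) (p q : CellField) :
    inner ℂ (mulField _ h.memLp_sqrt p) (mulField _ h.memLp_sqrt q) =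
      inner ℂ (p 0) (mulCell m h.memLp (q 0)) + inner ℂ (p 1) (mulCell m h.memLp (q 1)) := by
  simp only [inner_field, mulField_apply, inner_mulCell,
    mulCell_mulCell h.memLp_sqrt h.memLp_sqrt h.memLp h.sqrt_mul_sqrt]

lemma IsElliptic.inv_sqrt_sqrt {m : Torus → ℝ} (h : IsElliptic m) (p : CellField) :
    mulField _ h.memLp_inv_sqrt (mulField _ h.memLp_sqrt p) = p := by
  ext1 j
  rw [mulField_apply, mulField_apply,
    mulCell_cancel h.memLp_inv_sqrt h.memLp_sqrt h.inv_sqrt_mul_sqrt]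

lemma IsElliptic.sqrt_inv_sqrt {m : Torus → ℝ} (h : IsElliptic m) (p : CellField) :
    mulField _ h.memLp_sqrt (mulField _ h.memLp_inv_sqrt p) = p := by
  ext1 j
  rw [mulField_apply, mulField_apply,
    mulCell_cancel h.memLp_sqrt h.memLp_inv_sqrt h.sqrt_mul_inv_sqrt]

/-- The closed subspace of gradient fields. -/
def gradientSubmodule : Submodule ℂ CellField where
  carrier := {p | IsGradientField p}
  zero_mem' := ⟨fun j => by simp [cellCoeff_zero], fun g => by simp [cellCoeff_zero]⟩
  add_mem' {p q} hp hq := by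
    refine ⟨fun j => ?_, fun g => ?_⟩
    · simp [cellCoeff_add, hp.1, hq.1]
    · simp only [PiLp.add_apply, cellCoeff_add]
      linear_combination hp.2 g + hq.2 g
  smul_mem' c p hp := by
    refine ⟨fun j => ?_, fun g => ?_⟩
    · simp [cellCoeff_smul, hp.1]
    · simp only [PiLp.smul_apply, cellCoeff_smul]
      linear_combination c * hp.2 g

lemma isClosed_gradientSubmodule : IsClosed (gradientSubmodule : Set CellField) := by
  have hc : ∀ (j : Fin 2) (g : Fin 2 → ℤ), Continuous fun p : CellField => cellCoeff (p j) g :=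
    fun j g => (continuous_cellCoeff g).comp (PiLp.continuous_apply 2 _ j)
  have hset : (gradientSubmodule : Set CellField) =
      (⋂ j, {p : CellField | cellCoeff (p j) 0 = 0}) ∩
      ⋂ g : Fin 2 → ℤ, {p : CellField |
        (g 0 : ℂ) * cellCoeff (p 1) g = (g 1 : ℂ) * cellCoeff (p 0) g} := by
    ext p
    simp only [Set.mem_inter_iff, Set.mem_iInter, Set.mem_ofPred_eq]
    rfl
  rw [hset]
  refine (isClosed_iInter fun j => isClosed_eq (hc j 0) continuous_const).inter
    (isClosed_iInter fun g => isClosed_eq ?_ ?_)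
  · exact continuous_const.mul (hc 1 g)
  · exact continuous_const.mul (hc 0 g)

/-- The gradient of a Fourier mode, up to the factor `2πi`. -/
def gradMode (g : Fin 2 → ℤ) : CellField := WithLp.toLp 2 fun j => (g j : ℂ) • cellBasis g

/-- A constant field. -/
def constField (κ : Fin 2 → ℂ) : CellField := WithLp.toLp 2 fun j => κ j • cellBasis 0

lemma gradMode_apply (g : Fin 2 → ℤ) (j : Fin 2) : gradMode g j = (g j : ℂ) • cellBasis g := rfl

lemma constField_apply (κ : Fin 2 → ℂ) (j : Fin 2) : constField κ j = κ j • cellBasis 0 := rfl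

lemma gradMode_mem (g : Fin 2 → ℤ) : gradMode g ∈ gradientSubmodule := by
  refine ⟨fun j => ?_, fun g' => ?_⟩
  · rw [gradMode_apply, cellCoeff_smul, cellCoeff_cellBasis]
    split_ifs with h
    · simp [show g = 0 from h.symm]
    · simp
  · rw [gradMode_apply, gradMode_apply, cellCoeff_smul, cellCoeff_smul, cellCoeff_cellBasis]
    split_ifs with h
    · simp [h, mul_comm]
    · simp

lemma constField_not_mem : constField ![1, 0] ∉ gradientSubmodule := fun h => by
  have := h.1 0
  simp [constField_apply, cellCoeff_cellBasis_zero] at this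

/-! ### The plane-wave expansion as a Galerkin method -/

namespace IsElliptic

variable {m : Torus → ℝ} (h : IsElliptic m)

/-- The weighted gradient of a Fourier mode. -/
def weightedMode (g : Fin 2 → ℤ) : CellField := mulField _ h.memLp_sqrt (gradMode g)

/-- The weighted constant field. -/
def weightedConst (κ : Fin 2 → ℂ) : CellField := mulField _ h.memLp_sqrt (constField κ)

/-- The Galerkin space spanned by the weighted gradients of the harmonics up to `N`. -/
def galerkinSpace (N : ℕ) : Submodule ℂ CellField :=
  Submodule.span ℂ (Set.range fun g : Harmonic N => h.weightedMode g.1)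

instance (N : ℕ) : FiniteDimensional ℂ (h.galerkinSpace N) :=
  FiniteDimensional.span_of_finite ℂ (Set.finite_range _)

lemma pweMatrix_eq (N : ℕ) : pweMatrix m N =
    Matrix.of fun g g' : Harmonic N => inner ℂ (h.weightedMode g.1) (h.weightedMode g'.1) := by
  ext g g'
  rw [Matrix.of_apply, weightedMode, weightedMode, h.inner_sqrt_sqrt]
  simp only [pweMatrix, Matrix.of_apply, gradMode_apply, map_smul, inner_smul_left,
    inner_smul_right, ← fourierHat_sub h.memLp, map_intCast, Fin.sum_univ_two]
  push_cast
  ring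

lemma pweVector_eq (N : ℕ) : pweVector m N =
    fun g : Harmonic N => inner ℂ (h.weightedMode g.1) (h.weightedConst ![1, 0]) := by
  ext g
  rw [weightedMode, weightedConst, h.inner_sqrt_sqrt]
  simp only [pweVector, gradMode_apply, constField_apply, map_smul, inner_smul_left,
    inner_smul_right, ← fourierHat_sub h.memLp, map_intCast, Matrix.cons_val_zero,
    Matrix.cons_val_one, sub_zero]
  ring

lemma cellMean_eq : (cellMean m : ℂ) =
    inner ℂ (h.weightedConst ![1, 0]) (h.weightedConst ![1, 0]) := by
  rw [weightedConst, h.inner_sqrt_sqrt, cellMean_eq_inner h.memLp]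
  simp [constField_apply]

include h in
lemma exists_pwe_solution (N : ℕ) : ∃ ξ : Harmonic N → ℂ, pweMatrix m N *ᵥ ξ = pweVector m N := by
  rw [h.pweMatrix_eq, h.pweVector_eq]
  exact exists_gram_solution _ _

lemma cellMean_sub_pwe {N : ℕ} {ξ : Harmonic N → ℂ} (hξ : pweMatrix m N *ᵥ ξ = pweVector m N) :
    (cellMean m : ℂ) - star (pweVector m N) ⬝ᵥ ξ =
      ((‖h.weightedConst ![1, 0] -
        (h.galerkinSpace N).starProjection (h.weightedConst ![1, 0])‖ ^ 2 : ℝ) : ℂ) := by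
  rw [h.pweMatrix_eq, h.pweVector_eq] at hξ
  rw [h.cellMean_eq, h.pweVector_eq]
  have : (Submodule.span ℂ
      (Set.range fun g : Harmonic N => h.weightedMode g.1)).HasOrthogonalProjection :=
    inferInstanceAs (h.galerkinSpace N).HasOrthogonalProjection
  exact gram_quadratic _ _ hξ

lemma muNN_eq (N : ℕ) : muNN m N = ‖h.weightedConst ![1, 0] -
    (h.galerkinSpace N).starProjection (h.weightedConst ![1, 0])‖ ^ 2 := by
  have hξ := Classical.epsilon_spec (h.exists_pwe_solution N)
  have := congrArg Complex.re (h.cellMean_sub_pwe hξ)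
  rwa [Complex.sub_re, Complex.ofReal_re, Complex.ofReal_re] at this

lemma galerkinSpace_mono : Monotone h.galerkinSpace := by
  intro N M hNM
  refine Submodule.span_mono ?_
  rintro _ ⟨g, rfl⟩
  refine ⟨⟨g.1, ?_⟩, rfl⟩
  have hg := g.2
  simp only [Fintype.mem_piFinset, Finset.mem_Icc] at hg ⊢
  intro j
  have := hg j
  omega

lemma galerkinSpace_le (N : ℕ) : h.galerkinSpace N ≤
    gradientSubmodule.comap (mulField _ h.memLp_inv_sqrt).toLinearMap := by
  refine Submodule.span_le.mpr ?_
  rintro _ ⟨g, rfl⟩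
  change mulField _ h.memLp_inv_sqrt (mulField _ h.memLp_sqrt (gradMode g)) ∈ gradientSubmodule
  rw [h.inv_sqrt_sqrt]
  exact gradMode_mem _

include h in
lemma antitone_muNN : Antitone (muNN m) := by
  intro N M hNM
  rw [h.muNN_eq, h.muNN_eq]
  exact pow_le_pow_left₀ (norm_nonneg _) (norm_sub_starProjection_le _ _
    (h.galerkinSpace_mono hNM (Submodule.starProjection_apply_mem _ _))) 2

include h in
lemma muNN_pos (N : ℕ) : 0 < muNN m N := by
  -- Zero distance would put the weighted constant in the Galerkin space; division by `√m` would
  -- then make the constant field a gradient.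
  rw [h.muNN_eq]
  refine pow_pos (norm_pos_iff.mpr fun h0 => constField_not_mem ?_) 2
  have := h.galerkinSpace_le N ((h.galerkinSpace N).starProjection_apply_mem
    (h.weightedConst ![1, 0]))
  rw [← sub_eq_zero.mp h0] at this
  change mulField _ h.memLp_inv_sqrt (mulField _ h.memLp_sqrt _) ∈ gradientSubmodule at this
  rwa [h.inv_sqrt_sqrt] at this

/-- The closure of the union of the Galerkin spaces. -/
def limitSpace : Submodule ℂ CellField := (⨆ N, h.galerkinSpace N).topologicalClosure

instance : h.limitSpace.HasOrthogonalProjection :=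
  have : CompleteSpace h.limitSpace :=
    (⨆ N, h.galerkinSpace N).isClosed_topologicalClosure.completeSpace_coe
  inferInstance

lemma limitSpace_le : h.limitSpace ≤
    gradientSubmodule.comap (mulField _ h.memLp_inv_sqrt).toLinearMap :=
  Submodule.topologicalClosure_minimal _ (iSup_le h.galerkinSpace_le)
    (isClosed_gradientSubmodule.preimage (mulField _ h.memLp_inv_sqrt).continuous)

lemma weightedMode_mem_limitSpace (g : Fin 2 → ℤ) : h.weightedMode g ∈ h.limitSpace := by
  refine Submodule.le_topologicalClosure _
    (le_iSup h.galerkinSpace (max (g 0).natAbs (g 1).natAbs) ?_)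
  refine Submodule.subset_span ⟨⟨g, ?_⟩, rfl⟩
  simp only [Fintype.mem_piFinset, Finset.mem_Icc]
  intro j
  fin_cases j <;> simp only [Fin.zero_eta, Fin.mk_one] <;> omega

/-- The corrector of the mean field `κ`. -/
def corrector (κ : Fin 2 → ℂ) : CellField :=
  mulField _ h.memLp_inv_sqrt (h.limitSpace.starProjection (h.weightedConst κ))

lemma weighted_sub_corrector (κ : Fin 2 → ℂ) :
    mulField _ h.memLp_sqrt (constField κ - h.corrector κ) =
      h.weightedConst κ - h.limitSpace.starProjection (h.weightedConst κ) := by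
  rw [map_sub, corrector, h.sqrt_inv_sqrt, weightedConst]

/-- The residual is orthogonal to each weighted mode gradient, which is exactly the vanishing of the
`g`-th Fourier coefficient of the divergence of the flux. That `limitSpace` contains only weighted
gradients suffices; equality is not needed. -/
lemma isCorrector_corrector (κ : Fin 2 → ℂ) : IsCorrector m h.memLp κ (h.corrector κ) where
  gradient := h.limitSpace_le (h.limitSpace.starProjection_apply_mem (h.weightedConst κ))
  divFree := by
    intro g
    have horth := inner_eq_zero_symm.mp (h.limitSpace.starProjection_inner_eq_zero
      (h.weightedConst κ) _ (h.weightedMode_mem_limitSpace g))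
    rw [← weighted_sub_corrector, weightedMode, h.inner_sqrt_sqrt] at horth
    simp only [gradMode_apply, PiLp.sub_apply, constField_apply, inner_smul_left, map_intCast]
      at horth
    exact horth

/-- The effective coefficient. -/
def effective : ℝ := (meanFlux m h.memLp ![1, 0] (h.corrector ![1, 0]) 0).re

lemma effective_eq_norm : h.effective = ‖h.weightedConst ![1, 0] -
    h.limitSpace.starProjection (h.weightedConst ![1, 0])‖ ^ 2 := by
  have he := (h.isCorrector_corrector ![1, 0]).meanFlux_eq_energy (h.isCorrector_corrector ![1, 0])
  have hi := h.inner_sqrt_sqrt (constField ![1, 0] - h.corrector ![1, 0])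
    (constField ![1, 0] - h.corrector ![1, 0])
  simp only [PiLp.sub_apply, constField_apply] at hi
  rw [← hi, weighted_sub_corrector, inner_self_eq_norm_sq_to_K] at he
  simp only [Matrix.cons_val_zero, Matrix.cons_val_one, map_one, map_zero, one_mul, zero_mul,
    add_zero] at he
  rw [effective, he]
  simp [← Complex.ofReal_pow]

lemma tendsto_muNN : Tendsto (muNN m) atTop (𝓝 h.effective) := by
  rw [effective_eq_norm]
  simp_rw [funext h.muNN_eq]
  have : (⨆ N, h.galerkinSpace N).topologicalClosure.HasOrthogonalProjection :=
    inferInstanceAs h.limitSpace.HasOrthogonalProjection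
  have ht := Submodule.starProjection_tendsto_closure_iSup h.galerkinSpace h.galerkinSpace_mono
    (h.weightedConst ![1, 0])
  exact ((tendsto_const_nhds.sub ht).norm).pow 2

end IsElliptic

/-! ### Smooth functions on the torus -/

/-- The covering map of the torus. -/
def torusMk (y : Fin 2 → ℝ) : Torus := fun i => (y i : UnitAddCircle)

lemma isOpenQuotientMap_torusMk : IsOpenQuotientMap torusMk :=
  IsOpenQuotientMap.piMap fun _ => QuotientAddGroup.isOpenQuotientMap_mk

lemma torusMk_add_single (y : Fin 2 → ℝ) (j : Fin 2) (t : ℝ) :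
    torusMk y + Pi.single j (t : UnitAddCircle) = torusMk (y + t • Pi.single j 1) := by
  ext i
  by_cases h : i = j
  · subst h; simp [torusMk]
  · simp [torusMk, h]

lemma torusMk_surjective (x : Torus) : ∃ y, torusMk y = x := isOpenQuotientMap_torusMk.surjective x

section Smooth

variable {φ ψ : Torus → ℂ}

lemma SmoothPeriodic.contDiff (h : SmoothPeriodic φ) : ContDiff ℝ ∞ (φ ∘ torusMk) := h

lemma SmoothPeriodic.continuous (h : SmoothPeriodic φ) : Continuous φ :=
  isOpenQuotientMap_torusMk.isQuotientMap.continuous_iff.mpr h.contDiff.continuous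

lemma SmoothPeriodic.mul (hφ : SmoothPeriodic φ) (hψ : SmoothPeriodic ψ) :
    SmoothPeriodic fun x => φ x * ψ x := ContDiff.mul hφ hψ

lemma SmoothPeriodic.hasDerivAt_lift (h : SmoothPeriodic φ) (j : Fin 2) (y : Fin 2 → ℝ) :
    HasDerivAt (fun t : ℝ => φ (torusMk y + Pi.single j (t : UnitAddCircle)))
      (fderiv ℝ (φ ∘ torusMk) y (Pi.single j 1)) 0 := by
  have hd : HasFDerivAt (φ ∘ torusMk) (fderiv ℝ (φ ∘ torusMk) (y + (0 : ℝ) • Pi.single j 1))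
      (y + (0 : ℝ) • Pi.single j 1) :=
    ((h.contDiff.differentiable (by simp)) _).hasFDerivAt
  have hl : HasDerivAt (fun t : ℝ => y + t • (Pi.single j 1 : Fin 2 → ℝ)) (Pi.single j 1) 0 := by
    simpa using ((hasDerivAt_id (0 : ℝ)).smul_const (Pi.single j 1 : Fin 2 → ℝ)).const_add y
  have := hd.comp_hasDerivAt (0 : ℝ) hl
  rw [zero_smul, add_zero] at this
  refine this.congr_of_eventuallyEq (Eventually.of_forall fun t => ?_)
  simp [torusMk_add_single]

lemma SmoothPeriodic.partialDeriv_torusMk (h : SmoothPeriodic φ) (j : Fin 2) (y : Fin 2 → ℝ) :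
    partialDeriv j φ (torusMk y) = fderiv ℝ (φ ∘ torusMk) y (Pi.single j 1) :=
  (h.hasDerivAt_lift j y).deriv

lemma SmoothPeriodic.hasDerivAt_zero (h : SmoothPeriodic φ) (j : Fin 2) (x : Torus) :
    HasDerivAt (fun t : ℝ => φ (x + Pi.single j (t : UnitAddCircle))) (partialDeriv j φ x) 0 := by
  obtain ⟨y, rfl⟩ := torusMk_surjective x
  rw [h.partialDeriv_torusMk]
  exact h.hasDerivAt_lift j y

lemma SmoothPeriodic.hasDerivAt (h : SmoothPeriodic φ) (j : Fin 2) (x : Torus) (t : ℝ) :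
    HasDerivAt (fun t : ℝ => φ (x + Pi.single j (t : UnitAddCircle)))
      (partialDeriv j φ (x + Pi.single j (t : UnitAddCircle))) t := by
  have h0 := h.hasDerivAt_zero j (x + Pi.single j (t : UnitAddCircle))
  rw [← sub_self t] at h0
  have := h0.comp_sub_const t t
  refine this.congr_of_eventuallyEq (Eventually.of_forall fun s => ?_)
  simp only [add_assoc, ← Pi.single_add, ← AddCircle.coe_add]
  simp

lemma SmoothPeriodic.continuous_partialDeriv (h : SmoothPeriodic φ) (j : Fin 2) :
    Continuous (partialDeriv j φ) := by
  refine isOpenQuotientMap_torusMk.isQuotientMap.continuous_iff.mpr ?_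
  have : partialDeriv j φ ∘ torusMk = fun y => fderiv ℝ (φ ∘ torusMk) y (Pi.single j 1) :=
    funext fun y => h.partialDeriv_torusMk j y
  rw [this]
  exact (h.contDiff.continuous_fderiv (by simp)).clm_apply continuous_const

lemma SmoothPeriodic.partialDeriv_mul (hφ : SmoothPeriodic φ) (hψ : SmoothPeriodic ψ)
    (j : Fin 2) (x : Torus) : partialDeriv j (fun x => φ x * ψ x) x =
      partialDeriv j φ x * ψ x + φ x * partialDeriv j ψ x := by
  have := ((hφ.hasDerivAt_zero j x).mul (hψ.hasDerivAt_zero j x)).deriv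
  exact (show partialDeriv j (fun x => φ x * ψ x) x = _ from this).trans (by simp)

lemma integrable_of_continuous {f : Torus → ℂ} (hf : Continuous f) : Integrable f cellMeasure :=
  hf.integrable_of_hasCompactSupport (HasCompactSupport.of_compactSpace f)

/-- The integral of the translate of `φ` by `t` along axis `j` does not depend on `t`;
differentiation under the integral at `t = 0` gives the claim. -/
lemma SmoothPeriodic.integral_partialDeriv (h : SmoothPeriodic φ) (j : Fin 2) :
    ∫ x, partialDeriv j φ x ∂cellMeasure = 0 := by
  obtain ⟨C, hC⟩ := (isCompact_range (h.continuous_partialDeriv j)).isBounded.exists_norm_le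
  let F : ℝ → Torus → ℂ := fun t x => φ (x + Pi.single j (t : UnitAddCircle))
  let F' : ℝ → Torus → ℂ := fun t x => partialDeriv j φ (x + Pi.single j (t : UnitAddCircle))
  have hF : ∀ t, Continuous (F t) := fun t => h.continuous.comp (continuous_add_const _)
  have hF' : ∀ t, Continuous (F' t) := fun t =>
    (h.continuous_partialDeriv j).comp (continuous_add_const _)
  have hbound : ∀ t x, ‖F' t x‖ ≤ C := fun t x => hC _ ⟨_, rfl⟩
  have hderiv : ∀ t x, HasDerivAt (F · x) (F' t x) t := fun t x => h.hasDerivAt j x t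
  have hint : ∀ t, ∫ x, F t x ∂cellMeasure = ∫ x, φ x ∂cellMeasure := fun t =>
    integral_add_right_eq_self φ _
  have hint' : ∫ x, F' 0 x ∂cellMeasure = ∫ x, partialDeriv j φ x ∂cellMeasure :=
    integral_add_right_eq_self (partialDeriv j φ) _
  clear_value F F'
  have hd := (hasDerivAt_integral_of_dominated_loc_of_deriv_le (μ := cellMeasure) (F := F)
    (F' := F') (x₀ := (0 : ℝ)) (bound := fun _ => C) (s := Set.univ) univ_mem
    (Eventually.of_forall fun t => (hF t).aestronglyMeasurable)
    (integrable_of_continuous (hF 0)) (hF' 0).aestronglyMeasurable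
    (Eventually.of_forall fun x t _ => hbound t x) (integrable_const _)
    (Eventually.of_forall fun x t _ => hderiv t x)).2
  rw [hint', funext hint] at hd
  exact hd.unique (hasDerivAt_const _ _)

end Smooth

lemma mFourier_lift (g : Fin 2 → ℤ) (y : Fin 2 → ℝ) : UnitAddTorus.mFourier g (torusMk y) =
    Complex.exp (2 * Real.pi * Complex.I * (g 0) * y 0) *
      Complex.exp (2 * Real.pi * Complex.I * (g 1) * y 1) := by
  simp only [UnitAddTorus.mFourier, ContinuousMap.coe_mk, Fin.prod_univ_two, torusMk,
    fourier_coe_apply, Complex.ofReal_one, div_one]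

lemma smoothPeriodic_mFourier (g : Fin 2 → ℤ) : SmoothPeriodic (UnitAddTorus.mFourier g) := by
  have : (fun y : Fin 2 → ℝ => UnitAddTorus.mFourier g fun i => (y i : UnitAddCircle)) =
      fun y => Complex.exp (2 * Real.pi * Complex.I * (g 0) * y 0) *
      Complex.exp (2 * Real.pi * Complex.I * (g 1) * y 1) := funext fun y => mFourier_lift g y
  rw [SmoothPeriodic, this]
  have hc : ∀ j : Fin 2, ContDiff ℝ ∞ fun y : Fin 2 → ℝ => ((y j : ℝ) : ℂ) := fun j =>
    Complex.ofRealCLM.contDiff.comp (contDiff_apply ℝ ℝ j)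
  exact ((contDiff_const.mul (hc 0)).cexp).mul ((contDiff_const.mul (hc 1)).cexp)

lemma partialDeriv_mFourier (g : Fin 2 → ℤ) (j : Fin 2) (x : Torus) :
    partialDeriv j (UnitAddTorus.mFourier g) x =
      2 * Real.pi * Complex.I * g j * UnitAddTorus.mFourier g x := by
  have hadd : ∀ t : ℝ, UnitAddTorus.mFourier g (x + Pi.single j (t : UnitAddCircle)) =
      UnitAddTorus.mFourier g x * fourier (g j) (t : UnitAddCircle) := by
    intro t
    fin_cases j <;> simp [UnitAddTorus.mFourier, AddCircle.toCircle_add] <;> ring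
  have hd := ((hasDerivAt_fourier (T := 1) (g j) 0).const_mul (UnitAddTorus.mFourier g x)).deriv
  rw [partialDeriv, funext hadd, hd]
  simp
  ring

/-! ### Periodic Sobolev functions in terms of Fourier coefficients -/

lemma memLp_of_continuous {f : Torus → ℂ} (hf : Continuous f) : MemLp f 2 cellMeasure :=
  hf.memLp_of_hasCompactSupport (HasCompactSupport.of_compactSpace f)

lemma integral_partialDeriv_mul_mFourier {φ : Torus → ℂ} (h : SmoothPeriodic φ) (j : Fin 2)
    (g : Fin 2 → ℤ) :
    ∫ x, partialDeriv j φ x * UnitAddTorus.mFourier g x ∂cellMeasure =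
      -(2 * Real.pi * Complex.I * g j) * ∫ x, φ x * UnitAddTorus.mFourier g x ∂cellMeasure := by
  have h0 := (h.mul (smoothPeriodic_mFourier g)).integral_partialDeriv j
  simp only [h.partialDeriv_mul (smoothPeriodic_mFourier g), partialDeriv_mFourier] at h0
  have hg : Continuous fun x : Torus => UnitAddTorus.mFourier g x := map_continuous _
  have i1 : Integrable (fun x => partialDeriv j φ x * UnitAddTorus.mFourier g x) cellMeasure :=
    integrable_of_continuous ((h.continuous_partialDeriv j).mul hg)
  have i2 : Integrable (fun x => φ x * (2 * Real.pi * Complex.I * g j *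
      UnitAddTorus.mFourier g x)) cellMeasure :=
    integrable_of_continuous (h.continuous.mul (continuous_const.mul hg))
  rw [integral_add i1 i2] at h0
  rw [eq_neg_of_add_eq_zero_left h0, neg_mul, ← integral_const_mul]
  congr 2
  ext x
  ring

/-- The weak gradient of an `H¹` function is a gradient field. -/
lemma IsH1WithGrad.isGradientField {u : Torus → ℂ} {p : Fin 2 → Torus → ℂ}
    (h : IsH1WithGrad u p) : IsGradientField fun j => (h.memLp_grad j).toLp (p j) := by
  have key : ∀ j g, cellCoeff ((h.memLp_grad j).toLp (p j)) g =
      2 * Real.pi * Complex.I * g j * cellCoeff (h.memLp.toLp u) g := by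
    intro j g
    -- The mode `-g` is the conjugate of the mode `g`, so testing with it extracts the `g`-th
    -- coefficients.
    have hw := h.weak_grad j _ (smoothPeriodic_mFourier (-g))
    simp only [partialDeriv_mFourier] at hw
    rw [cellCoeff_toLp, cellCoeff_toLp, ← integral_const_mul]
    simp only [← UnitAddTorus.mFourier_neg]
    rw [eq_neg_iff_add_eq_zero, add_comm, ← eq_neg_iff_add_eq_zero] at hw
    rw [hw, ← integral_neg]
    congr 1
    ext x
    simp only [Pi.neg_apply, Int.cast_neg]
    ring
  refine ⟨fun j => ?_, fun g => ?_⟩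
  · simp [key]
  · rw [key, key]
    ring

lemma cellCoeff_star_toLp {φ : Torus → ℂ} (hφ : MemLp φ 2 cellMeasure) (g : Fin 2 → ℤ) :
    conj (cellCoeff (star (hφ.toLp φ)) g) =
      ∫ x, φ x * UnitAddTorus.mFourier g x ∂cellMeasure := by
  rw [cellCoeff_star, Complex.conj_conj, cellCoeff_toLp]
  simp [UnitAddTorus.mFourier_neg]

lemma inner_star_toLp {φ : Torus → ℂ} (hφ : MemLp φ 2 cellMeasure) (f : CellL2) :
    inner ℂ (star (hφ.toLp φ)) f = ∫ x, f x * φ x ∂cellMeasure := by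
  rw [inner_cell]
  refine integral_congr_ae ?_
  filter_upwards [Lp.coeFn_star (hφ.toLp φ), hφ.coeFn_toLp] with x h1 h2
  rw [h1, Pi.star_apply, h2]
  simp

/-- Parseval against an arbitrary smooth `φ` reduces integration by parts to the single modes, where
it holds for `φ` by smoothness. -/
lemma isH1WithGrad_of_cellCoeff {u : CellL2} {p : Fin 2 → CellL2}
    (h : ∀ j g, cellCoeff (p j) g = 2 * Real.pi * Complex.I * g j * cellCoeff u g) :
    IsH1WithGrad u fun j => p j where
  memLp := Lp.memLp u
  memLp_grad j := Lp.memLp (p j)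
  weak_grad j φ hφ := by
    have hm := memLp_of_continuous hφ.continuous
    have hm' := memLp_of_continuous (hφ.continuous_partialDeriv j)
    rw [← inner_star_toLp hm, ← inner_star_toLp hm', eq_neg_iff_add_eq_zero]
    refine ((hasSum_cellCoeff _ _).add (hasSum_cellCoeff _ _)).unique ?_
    convert hasSum_zero using 2 with g
    rw [cellCoeff_star_toLp, cellCoeff_star_toLp, integral_partialDeriv_mul_mFourier hφ, h]
    ring

lemma summable_cellCoeff_sq (f : CellL2) : Summable fun g => ‖cellCoeff f g‖ ^ 2 := by
  have := (lp.memℓp (cellBasis.repr f)).summable (by norm_num)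
  simpa [HilbertBasis.repr_apply_apply, cellCoeff] using this

/-- Every gradient field is the weak gradient of an `H¹` function. -/
lemma IsGradientField.exists_potential {p : Fin 2 → CellL2} (hp : IsGradientField p) :
    ∃ u : Torus → ℂ, IsH1WithGrad u fun j => p j := by
  -- The coefficient is recovered from a component of `g` that is nonzero. At `g = 0` division by
  -- zero gives `0`, so the potential has zero mean.
  set c : (Fin 2 → ℤ) → ℂ := fun g =>
    if g 0 ≠ 0 then cellCoeff (p 0) g / (2 * Real.pi * Complex.I * g 0)
    else cellCoeff (p 1) g / (2 * Real.pi * Complex.I * g 1) with hc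
  -- For `n ≠ 0` the divisor has modulus at least 1, so `c` inherits square summability from `p`.
  have hdiv : ∀ (z : ℂ) (n : ℤ), ‖z / (2 * Real.pi * Complex.I * n)‖ ≤ ‖z‖ := by
    intro z n
    by_cases hn : n = 0
    · simp [hn]
    · rw [norm_div]
      refine div_le_self (norm_nonneg _) ?_
      have h1 : (1 : ℝ) ≤ |(n : ℝ)| := by exact_mod_cast Int.one_le_abs hn
      have h2 := Real.pi_gt_three
      simp only [norm_mul, Complex.norm_I, Complex.norm_real, Complex.norm_intCast,
        Real.norm_of_nonneg Real.pi_pos.le, RCLike.norm_ofNat, mul_one]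
      nlinarith
  have hmem : Memℓp c 2 := by
    refine memℓp_gen (((summable_cellCoeff_sq (p 0)).add
      (summable_cellCoeff_sq (p 1))).of_nonneg_of_le (fun g => by positivity) fun g => ?_)
    have h0 := pow_le_pow_left₀ (norm_nonneg _) (hdiv (cellCoeff (p 0) g) (g 0)) 2
    have h1 := pow_le_pow_left₀ (norm_nonneg _) (hdiv (cellCoeff (p 1) g) (g 1)) 2
    have n0 := sq_nonneg ‖cellCoeff (p 0) g‖
    have n1 := sq_nonneg ‖cellCoeff (p 1) g‖
    simp only [hc, ENNReal.toReal_ofNat, Real.rpow_ofNat]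
    split_ifs <;> linarith
  refine ⟨cellBasis.repr.symm ⟨c, hmem⟩, isH1WithGrad_of_cellCoeff fun j g => ?_⟩
  have hu : cellCoeff (cellBasis.repr.symm ⟨c, hmem⟩) g = c g := by
    rw [cellCoeff, ← HilbertBasis.repr_apply_apply, LinearIsometryEquiv.apply_symm_apply]
  have hpi : (Real.pi : ℂ) ≠ 0 := by exact_mod_cast Real.pi_ne_zero
  have hI := Complex.I_ne_zero
  have hg := hp.2 g
  rw [hu, hc]
  by_cases h0 : g 0 = 0
  · by_cases h1 : g 1 = 0
    · have hg0 : g = 0 := by ext j; fin_cases j <;> simpa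
      simp [hg0, hp.1]
    · have h1' : (g 1 : ℂ) ≠ 0 := by exact_mod_cast h1
      rw [h0, Int.cast_zero, zero_mul, zero_eq_mul] at hg
      have hp0 := hg.resolve_left h1'
      fin_cases j
      · simp [h0, hp0]
      · simp only [h0, ne_eq, not_true_eq_false, if_false, Fin.mk_one]
        field_simp
  · have h0' : (g 0 : ℂ) ≠ 0 := by exact_mod_cast h0
    fin_cases j <;> simp only [h0, ne_eq, not_false_eq_true, if_true, Fin.zero_eta, Fin.mk_one]
    · field_simp
    · field_simp
      linear_combination hg

/-! ### The cell problem -/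

section CellProblem

variable {m : Torus → ℝ} (hm : MemLp (fun x => (m x : ℂ)) ⊤ cellMeasure)

lemma coeFn_cellBasis_zero : (cellBasis 0 : Torus → ℂ) =ᵐ[cellMeasure] fun _ => 1 := by
  filter_upwards [coeFn_cellBasis 0] with x hx
  simp [hx, UnitAddTorus.mFourier_zero]

lemma integrable_mul_conj (f f' : CellL2) :
    Integrable (fun x => f' x * conj (f x)) cellMeasure := by
  simpa [RCLike.inner_apply] using L2.integrable_inner (𝕜 := ℂ) f f'

lemma formC0_eq {p q : Fin 2 → Torus → ℂ} {P Q : Fin 2 → CellL2}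
    (hp : ∀ j, P j =ᵐ[cellMeasure] p j) (hq : ∀ j, Q j =ᵐ[cellMeasure] q j) :
    formC0 m p q = inner ℂ (Q 0) (mulCell m hm (P 0)) + inner ℂ (Q 1) (mulCell m hm (P 1)) := by
  rw [inner_cell, inner_cell, ← integral_add (integrable_mul_conj _ _) (integrable_mul_conj _ _)]
  refine integral_congr_ae ?_
  filter_upwards [hp 0, hp 1, hq 0, hq 1, coeFn_mulCell hm (P 0), coeFn_mulCell hm (P 1)]
    with x h1 h2 h3 h4 h5 h6
  rw [h5, h6, h1, h2, h3, h4, Fin.sum_univ_two]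
  ring

/-- The constant `1` has zero gradient, so only the flux of the constant field `iκ` paired with `∇v`
remains. This is why the cell problem corresponds to the corrector of `iκ` rather than of `κ`. -/
lemma formC1_one_left (κ : EuclideanSpace ℝ (Fin 2)) (v : Torus → ℂ) {q : Fin 2 → Torus → ℂ}
    {Q : Fin 2 → CellL2} (hq : ∀ j, Q j =ᵐ[cellMeasure] q j) :
    formC1 m κ 1 0 v q = inner ℂ (Q 0) (mulCell m hm ((Complex.I * κ 0) • cellBasis 0)) +
      inner ℂ (Q 1) (mulCell m hm ((Complex.I * κ 1) • cellBasis 0)) := by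
  rw [inner_cell, inner_cell, ← integral_add (integrable_mul_conj _ _) (integrable_mul_conj _ _)]
  simp only [formC1, Pi.zero_apply, mul_zero, Finset.sum_const_zero, zero_mul, integral_zero,
    zero_add]
  refine integral_congr_ae ?_
  filter_upwards [hq 0, hq 1, coeFn_mulCell hm ((Complex.I * κ 0) • cellBasis 0),
    coeFn_mulCell hm ((Complex.I * κ 1) • cellBasis 0),
    Lp.coeFn_smul (Complex.I * (κ 0 : ℂ)) (cellBasis 0),
    Lp.coeFn_smul (Complex.I * (κ 1 : ℂ)) (cellBasis 0), coeFn_cellBasis_zero]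
    with x h1 h2 h3 h4 h5 h6 h7
  rw [h3, h4, h5, h6, Pi.smul_apply, Pi.smul_apply, h7, h1, h2, Fin.sum_univ_two]
  simp only [Pi.one_apply, smul_eq_mul]
  ring

lemma formC1_one_right (κ : EuclideanSpace ℝ (Fin 2)) (w : Torus → ℂ) {p : Fin 2 → Torus → ℂ}
    {P : Fin 2 → CellL2} (hp : ∀ j, P j =ᵐ[cellMeasure] p j) :
    formC1 m κ w p 1 0 = -Complex.I * κ 0 * cellCoeff (mulCell m hm (P 0)) 0 +
      -Complex.I * κ 1 * cellCoeff (mulCell m hm (P 1)) 0 := by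
  rw [cellCoeff, cellCoeff, inner_cell, inner_cell, ← integral_const_mul, ← integral_const_mul,
    ← integral_add ((integrable_mul_conj _ _).const_mul _) ((integrable_mul_conj _ _).const_mul _)]
  simp only [formC1, Pi.zero_apply, map_zero, mul_zero, Finset.sum_const_zero, integral_zero,
    add_zero]
  refine integral_congr_ae ?_
  filter_upwards [hp 0, hp 1, coeFn_mulCell hm (P 0), coeFn_mulCell hm (P 1),
    coeFn_cellBasis_zero] with x h1 h2 h3 h4 h5
  rw [h3, h4, h1, h2, h5, Fin.sum_univ_two]
  simp only [Pi.one_apply, map_one]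
  ring

/-- Correctors solve the cell problem. -/
lemma IsCorrector.isCellSolution {κ : EuclideanSpace ℝ (Fin 2)} {p : Fin 2 → CellL2}
    (hp : IsCorrector m hm (fun j => Complex.I * κ j) p) {w : Torus → ℂ}
    (hw : IsH1WithGrad w fun j => p j) : IsCellSolution m κ w fun j => p j := by
  refine ⟨hw, fun v q hv => ?_⟩
  have hq := fun j => (hv.memLp_grad j).coeFn_toLp
  rw [formC0_eq hm (fun j => EventuallyEq.rfl) hq, formC1_one_left hm κ v hq]
  have := hv.isGradientField.inner_eq_zero hp.divFree
  simp only [map_sub, inner_sub_right] at this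
  linear_combination -this

/-- The gradient of a solution of the cell problem is a corrector. -/
lemma IsCellSolution.isCorrector {κ : EuclideanSpace ℝ (Fin 2)} {w : Torus → ℂ}
    {p : Fin 2 → Torus → ℂ} (h : IsCellSolution m κ w p) :
    IsCorrector m hm (fun j => Complex.I * κ j) fun j => (h.1.memLp_grad j).toLp (p j) where
  gradient := h.1.isGradientField
  divFree := by
    intro g
    -- A test function whose gradient is a single mode isolates one Fourier coefficient of the
    -- divergence of the flux.
    obtain ⟨v, hv⟩ := IsGradientField.exists_potential (gradMode_mem g)
    have := h.2 v _ hv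
    rw [formC0_eq hm (fun j => (h.1.memLp_grad j).coeFn_toLp) (fun j => EventuallyEq.rfl),
      formC1_one_left hm κ v fun j => EventuallyEq.rfl] at this
    simp only [gradMode_apply, inner_smul_left, map_intCast] at this
    simp only [map_sub, cellCoeff_sub]
    simp only [cellCoeff]
    linear_combination -this

end CellProblem

/-! ### The effective coefficient from the cell problem -/

namespace IsElliptic

variable {m : Torus → ℝ} (h : IsElliptic m)

include h in
lemma exists_isCellSolution (κ : EuclideanSpace ℝ (Fin 2)) :
    ∃ (w : Torus → ℂ) (p : Fin 2 → Torus → ℂ), IsCellSolution m κ w p := by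
  have hc := h.isCorrector_corrector fun j => Complex.I * κ j
  obtain ⟨w, hw⟩ := hc.gradient.exists_potential
  exact ⟨w, _, hc.isCellSolution h.memLp hw⟩

/-- Isotropy gives `⟨m (iκ - p)⟩ = iακ` with `α` the effective coefficient. Hence `-iκ · ⟨m p⟩ =
(⟨m⟩ - α) |κ|²`, and `|κ| = 1`. -/
lemma cellMean_sub_formC1 (hsymm : ∀ x, m (rotQuarter x) = m x) {κ : EuclideanSpace ℝ (Fin 2)}
    (hκ : ‖κ‖ = 1) {w : Torus → ℂ} {p : Fin 2 → Torus → ℂ} (hw : IsCellSolution m κ w p) :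
    (cellMean m : ℂ) - formC1 m κ w p 1 0 = (h.effective : ℂ) := by
  have hc := hw.isCorrector h.memLp
  have hf := (h.isCorrector_corrector ![1, 0]).meanFlux_isotropic h.pos hsymm hc
  rw [formC1_one_right h.memLp κ w fun j => (hw.1.memLp_grad j).coeFn_toLp,
    cellMean_eq_inner h.memLp]
  have f0 := hf 0
  have f1 := hf 1
  simp only [meanFlux, map_sub, map_smul, cellCoeff_sub, cellCoeff_smul] at f0 f1
  have hnorm : (κ 0 : ℂ) ^ 2 + (κ 1 : ℂ) ^ 2 = 1 := by
    have : κ 0 ^ 2 + κ 1 ^ 2 = 1 := by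
      have := EuclideanSpace.real_norm_sq_eq κ
      rw [Fin.sum_univ_two, hκ] at this
      linarith
    rw [← Complex.ofReal_pow, ← Complex.ofReal_pow, ← Complex.ofReal_add, this,
      Complex.ofReal_one]
  simp only [effective, meanFlux, map_sub, map_smul, cellCoeff_sub, cellCoeff_smul]
  simp only [cellCoeff] at f0 f1 ⊢
  generalize ((![1, 0] : Fin 2 → ℂ) 0 * inner ℂ (cellBasis 0) ((mulCell m h.memLp) (cellBasis 0)) -
    inner ℂ (cellBasis 0) ((mulCell m h.memLp) ((h.corrector ![1, 0]) 0))).re = α at *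
  linear_combination (-Complex.I * κ 0) * f0 + (-Complex.I * κ 1) * f1 + α * hnorm +
    (-inner ℂ (cellBasis 0) ((mulCell m h.memLp) (cellBasis 0))) * hnorm +
    (inner ℂ (cellBasis 0) ((mulCell m h.memLp) (cellBasis 0)) - α) *
      ((κ 0 : ℂ) ^ 2 + (κ 1 : ℂ) ^ 2) * Complex.I_sq

lemma muEff_eq (hsymm : ∀ x, m (rotQuarter x) = m x) {κ : EuclideanSpace ℝ (Fin 2)}
    (hκ : ‖κ‖ = 1) : muEff m κ = h.effective := by
  obtain ⟨w, p, hwp⟩ := h.exists_isCellSolution κ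
  have hs := Classical.epsilon_spec (p := fun w : (Torus → ℂ) × (Fin 2 → Torus → ℂ) =>
    IsCellSolution m κ w.1 w.2) ⟨(w, p), hwp⟩
  have := congrArg Complex.re (h.cellMean_sub_formC1 hsymm hκ hs)
  rwa [Complex.sub_re, Complex.ofReal_re, Complex.ofReal_re] at this

end IsElliptic

end

theorem theorem1 (μ : Torus → ℝ) (hmeas : AEMeasurable μ cellMeasure) (a b : ℝ) (ha : 0 < a)
    (hab : ∀ᵐ x ∂cellMeasure, a ≤ μ x ∧ μ x ≤ b)
    (hcubic : ∀ x : Torus, μ (rotQuarter x) = μ x) :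
    -- the finite-dimensional quantities are well defined
    (∀ N : ℕ, ∃ ξ : Harmonic N → ℂ, pweMatrix μ N *ᵥ ξ = pweVector μ N) ∧
    (∀ (N : ℕ) (ξ : Harmonic N → ℂ), pweMatrix μ N *ᵥ ξ = pweVector μ N →
      (muNN μ N : ℂ) = (cellMean μ : ℂ) - star (pweVector μ N) ⬝ᵥ ξ) ∧
    (∀ N : ℕ, 0 < muNN μ N ∧ 0 < muNN (fun x => (μ x)⁻¹) N) ∧
    -- the effective coefficient is well defined
    (∀ κ : EuclideanSpace ℝ (Fin 2), ‖κ‖ = 1 →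
      (∃ (w : Torus → ℂ) (p : Fin 2 → Torus → ℂ), IsCellSolution μ κ w p) ∧
      (∀ (w : Torus → ℂ) (p : Fin 2 → Torus → ℂ), IsCellSolution μ κ w p →
        (muEff μ κ : ℂ) = (cellMean μ : ℂ) - formC1 μ κ w p 1 0)) ∧
    -- monotone convergence from above and from below, whatever the direction
    Antitone (muNN μ) ∧
    Monotone (muTildeNN μ) ∧
    (∀ κ : EuclideanSpace ℝ (Fin 2), ‖κ‖ = 1 →
      Tendsto (muNN μ) atTop (𝓝 (muEff μ κ)) ∧
      Tendsto (muTildeNN μ) atTop (𝓝 (muEff μ κ))) := by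
  have h : IsElliptic μ := isElliptic_of_bounds hmeas ha hab
  -- The bounds hold at some point, which yields `0 < b` and so a positive lower bound `b⁻¹` for
  -- `1/μ`.
  obtain ⟨x₀, hx₀⟩ := hab.exists
  have hb : 0 < b := ha.trans_le (hx₀.1.trans hx₀.2)
  have hi : IsElliptic fun x => (μ x)⁻¹ := by
    refine isElliptic_of_bounds hmeas.inv (inv_pos.mpr hb) (b := a⁻¹) ?_
    filter_upwards [hab] with x hx
    exact ⟨inv_anti₀ (ha.trans_le hx.1) hx.2, inv_anti₀ ha hx.1⟩
  have hprod : h.effective * hi.effective = 1 := by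
    refine meanFlux_mul_dual h.pos hcubic (h.isCorrector_corrector _) hi.memLp ?_ ?_
      (hi.isCorrector_corrector _)
    · filter_upwards [h.pos] with x hx
      exact inv_mul_cancel₀ hx.ne'
    · exact fun x => congrArg _ (hcubic x)
  have heff : h.effective = 1 / hi.effective := eq_one_div_of_mul_eq_one_left hprod
  refine ⟨h.exists_pwe_solution, fun N ξ hξ => ?_, fun N => ⟨h.muNN_pos N, hi.muNN_pos N⟩,
    fun κ hκ => ⟨h.exists_isCellSolution κ, fun w p hw => ?_⟩, h.antitone_muNN, fun N M hNM => ?_,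
    fun κ hκ => ⟨?_, ?_⟩⟩
  · rw [h.cellMean_sub_pwe hξ, h.muNN_eq]
  · rw [h.cellMean_sub_formC1 hcubic hκ hw, h.muEff_eq hcubic hκ]
  -- Inversion reverses the monotonicity of the positive upper bounds for `1/μ`.
  · exact one_div_le_one_div_of_le (hi.muNN_pos M) (hi.antitone_muNN hNM)
  · rw [h.muEff_eq hcubic hκ]
    exact h.tendsto_muNN
  · rw [h.muEff_eq hcubic hκ, heff]
    exact tendsto_const_nhds.div hi.tendsto_muNN (right_ne_zero_of_mul_eq_one hprod)
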